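/- Let $\mathcal H$ be a separable infinite-dimensional complex Hilbert space and let $\alpha>1$. A state is a positive trace-class operator on $\mathcal H$ with unit trace. For $p\ge 1$ write $\Vert A\Vert_p=(\operatorname{tr}|A|^p)^{1/p}$ for the Schatten $p$-norm, and for a state $\rho$ put $$T_\alpha(\rho)=\frac{\operatorname{tr}(\rho^\alpha)-1}{1-\alpha},\qquad R_\alpha(\rho)=\frac{\log\operatorname{tr}(\rho^\alpha)}{1-\alpha}$$ (the $\alpha$-Tsallis and $\alpha$-Rényi entropies). These are well defined, since $0<\operatorname{tr}(\rho^\alpha)<\infty$ for every state $\rho$, and $\rho-\sigma$ lies in the Schatten class $\mathcal S_\alpha$ for all states $\rho,\sigma$. **Tsallis entropy.** The $\alpha$-Tsallis entropy is Lipschitz continuous with respect to the Schatten $\alpha$-distance: for all states $\rho,\sigma$, $$|T_\alpha(\rho)-T_\alpha(\sigma)|\le\frac{\big|\Vert\rho\Vert_\alpha^\alpha-\Vert\sigma\Vert_\alpha^\alpha\big|}{\alpha-1}\le\frac{\alpha}{\alpha-1}\Vert\rho-\sigma\Vert_\alpha .$$ **Rényi entropy.** The $\alpha$-Rényi entropy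 is not uniformly continuous on the set of all states, neither with respect to the Schatten $\alpha$-distance $\Vert\rho-\sigma\Vert_\alpha$ nor with respect to the trace distance $\Vert\rho-\sigma\Vert_1$. However, let $\rho,\sigma$ be states such that at least one of the following two conditions holds: 1. $\operatorname{tr}(\rho^\alpha)\ge\delta^{-1}$ and $\operatorname{tr}(\sigma^\alpha)\ge\delta^{-1}$ for some $\delta>0$; or 2. there are a self-adjoint, possibly unbounded, positive definite operator $\hat H$ on $\mathcal H$ (that is, $\langle x,\hat Hx\rangle>0$ for all nonzero $x$ in its domain), a real number $E$ and some $\beta\in(0,1)$ such that $\operatorname{tr}(\hat H\rho)\le E$, $\operatorname{tr}(\hat H\sigma)\le E$ and $$\tau:=\operatorname{tr}\Big(\hat H^{-\frac{\alpha\beta}{(1-\beta)(\alpha-1)}}\Big)<\infty ;$$ in this case put $\delta:=E^{\frac{\alpha\beta}{1-\beta}}\,\tau^{\alpha-1}$, which is strictly positive. Here $\operatorname{tr}(\hat H\rho):=\sup_{n\in\mathbb N}\operatorname{tr}\big(\hat H\,\mathbf 1_{[0,n]}(\hat H)\,\rho\big)\in[0,\infty]$, where $\mathbf 1_{[0,n]}(\hat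 H)$ is the spectral projection of $\hat H$ onto $[0,n]$. Then $$|R_\alpha(\rho)-R_\alpha(\sigma)|\le\frac{\alpha\,\delta}{\alpha-1}\,\Vert\rho-\sigma\Vert_\alpha .$$ -/

import Mathlib

open MeasureTheory
open scoped ENNReal

noncomputable section

namespace QuantumEntropy

variable {H : Type*} [NormedAddCommGroup H] [InnerProductSpace ℂ H] [CompleteSpace H]

variable (H) in
/-- The index set of a fixed orthonormal (Hilbert) basis of `H`. -/
def BasisIndex : Set H := (exists_hilbertBasis ℂ H).choose

variable (H) in
/-- A fixed orthonormal (Hilbert) basis of `H`, used to write down traces. -/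
def stdBasis : HilbertBasis (BasisIndex H) ℂ H := (exists_hilbertBasis ℂ H).choose_spec.choose

/-- The trace `∑ᵢ ⟨eᵢ, T eᵢ⟩ ∈ [0, ∞]` of a positive bounded operator `T`.
It does not depend on the orthonormal basis, see `posTrace_eq_tsum`. -/
def posTrace (T : H →L[ℂ] H) : ℝ≥0∞ :=
  ∑' i, ENNReal.ofReal (inner ℂ (stdBasis H i) (T (stdBasis H i))).re

theorem tsum_ofReal_norm_inner_sq {ι : Type*} (b : HilbertBasis ι ℂ H) (x : H) :
    ∑' i, ENNReal.ofReal (‖inner ℂ (b i) x‖ ^ 2) = ENNReal.ofReal (‖x‖ ^ 2) := by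
  have h := b.hasSum_inner_mul_inner x x
  have h2 : HasSum (fun i => ‖inner ℂ (b i) x‖ ^ 2) (‖x‖ ^ 2) := by
    have h3 := Complex.hasSum_re h
    have e : (inner ℂ x x : ℂ).re = ‖x‖ ^ 2 := by
      rw [inner_self_eq_norm_sq_to_K]; norm_cast
    rw [e] at h3
    convert h3 using 2 with i
    have h4 := inner_mul_symm_re_eq_norm (𝕜 := ℂ) x (b i)
    rw [norm_mul, norm_inner_symm x, ← sq] at h4
    exact h4.symm
  rw [← h2.tsum_eq, ENNReal.ofReal_tsum_of_nonneg (fun i => by positivity) h2.summable]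

theorem posTrace_eq_tsum {ι : Type*} (b : HilbertBasis ι ℂ H) (T : H →L[ℂ] H)
    (hT : T.IsPositive) :
    posTrace T = ∑' i, ENNReal.ofReal (inner ℂ (b i) (T (b i))).re := by
  have hT0 : 0 ≤ T := ContinuousLinearMap.nonneg_iff_isPositive T |>.2 hT
  have key : ∀ x, (inner ℂ x (T x)).re = ‖CFC.sqrt T x‖ ^ 2 := by
    intro x
    have hs : IsSelfAdjoint (CFC.sqrt T) := (CFC.sqrt_nonneg T).isSelfAdjoint
    have h1 : T x = CFC.sqrt T (CFC.sqrt T x) := by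
      conv_lhs => rw [← CFC.sqrt_mul_sqrt_self T hT0]
      rfl
    rw [h1, ← ContinuousLinearMap.adjoint_inner_left, hs.adjoint_eq,
      inner_self_eq_norm_sq_to_K]
    norm_cast
  have symm : ∀ x y, ‖inner ℂ x (CFC.sqrt T y)‖ = ‖inner ℂ y (CFC.sqrt T x)‖ := by
    intro x y
    have hs : IsSelfAdjoint (CFC.sqrt T) := (CFC.sqrt_nonneg T).isSelfAdjoint
    rw [← ContinuousLinearMap.adjoint_inner_left, hs.adjoint_eq, norm_inner_symm]
  unfold posTrace
  simp_rw [key]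
  calc _ = ∑' i, ∑' j, ENNReal.ofReal (‖inner ℂ (b j) (CFC.sqrt T (stdBasis H i))‖ ^ 2) := by
        simp_rw [tsum_ofReal_norm_inner_sq]
    _ = ∑' j, ∑' i, ENNReal.ofReal (‖inner ℂ (b j) (CFC.sqrt T (stdBasis H i))‖ ^ 2) :=
        ENNReal.tsum_comm
    _ = _ := by
        simp_rw [symm (b _) (stdBasis H _), tsum_ofReal_norm_inner_sq]

/-- A state (density operator): a positive trace-class operator of unit trace. -/
structure IsState (ρ : H →L[ℂ] H) : Prop where
  isPositive : ρ.IsPositive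
  posTrace_eq_one : posTrace ρ = 1

/-- `A` belongs to the Schatten class `S_p` (`p ≥ 1`): `tr |A| ^ p < ∞`. -/
def MemSchatten (p : ℝ) (A : H →L[ℂ] H) : Prop := posTrace (CFC.abs A ^ p) < ∞

/-- The Schatten norm `‖A‖_p = (tr |A| ^ p) ^ (1 / p)` of `A ∈ S_p`. -/
def schattenNorm (p : ℝ) (A : H →L[ℂ] H) : ℝ := (posTrace (CFC.abs A ^ p)).toReal ^ (1 / p)

/-- The `α`-Tsallis entropy `(tr ρ ^ α - 1) / (1 - α)`. -/
def tsallisEntropy (α : ℝ) (ρ : H →L[ℂ] H) : ℝ := ((posTrace (ρ ^ α)).toReal - 1) / (1 - α)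

/-- The `α`-Rényi entropy `log (tr ρ ^ α) / (1 - α)`. -/
def renyiEntropy (α : ℝ) (ρ : H →L[ℂ] H) : ℝ := Real.log (posTrace (ρ ^ α)).toReal / (1 - α)

/-- The real function `F` of states is uniformly continuous on the set of all states of `H` with
respect to the distance `‖ρ - σ‖_p`. -/
def UniformContinuousOnStates (p : ℝ) (F : (H →L[ℂ] H) → ℝ) : Prop :=
  ∀ ε : ℝ, 0 < ε → ∃ η : ℝ, 0 < η ∧ ∀ ρ σ : H →L[ℂ] H, IsState ρ → IsState σ →
    schattenNorm p (ρ - σ) < η → |F ρ - F σ| < ε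

/-- A positive definite Hamiltonian: a (densely defined, in general unbounded) self-adjoint
operator `A` with `⟨x, A x⟩ > 0` for all nonzero `x` in its domain. -/
structure IsPosDefHamiltonian (A : H →ₗ.[ℂ] H) : Prop where
  isSelfAdjoint : IsSelfAdjoint A
  inner_pos : ∀ x : A.domain, (x : H) ≠ 0 → 0 < (inner ℂ (x : H) (A x)).re

/-- A spectral resolution of a self-adjoint operator `A`: a projection-valued measure `proj` on
`ℝ`, with scalar measures `meas x = ⟨x, proj · x⟩`, such that `A = ∫ t d(proj)`, that is,
`dom A = {x | ∫ t² d(meas x) < ∞}` and `⟨x, A x⟩ = ∫ t d(meas x)` for `x ∈ dom A`. -/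
structure SpectralResolution (A : H →ₗ.[ℂ] H) where
  proj : Set ℝ → H →L[ℂ] H
  meas : H → Measure ℝ
  isStarProjection : ∀ S, MeasurableSet S → IsStarProjection (proj S)
  proj_univ : proj Set.univ = 1
  proj_inter : ∀ S T, MeasurableSet S → MeasurableSet T → proj (S ∩ T) = proj S * proj T
  meas_apply : ∀ x S, MeasurableSet S → meas x S = ENNReal.ofReal (inner ℂ x (proj S x)).re
  mem_domain_iff : ∀ x, x ∈ A.domain ↔ ∫⁻ t, ENNReal.ofReal (t ^ 2) ∂(meas x) < ∞
  inner_apply : ∀ x : A.domain, inner ℂ (x : H) (A x) = ((∫ t, t ∂(meas (x : H)) : ℝ) : ℂ)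

open Classical in
/-- The spectral projection `1_S(A)` of a self-adjoint operator `A`. (A self-adjoint operator has
exactly one projection-valued measure; the value `0` is only taken for operators without one.) -/
def spectralProjection (A : H →ₗ.[ℂ] H) (S : Set ℝ) : H →L[ℂ] H :=
  if h : Nonempty (SpectralResolution A) then h.some.proj S else 0

open Classical in
/-- `A x` for `x` in the domain of `A`, and `0` otherwise. -/
def applyOrZero (A : H →ₗ.[ℂ] H) (x : H) : H := if h : x ∈ A.domain then A ⟨x, h⟩ else 0

/-- The truncated energy `tr (A 1_{[0,n]}(A) ρ)`. The bounded operator `A 1_{[0,n]}(A)` is everywhere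
defined because the range of `1_{[0,n]}(A)` lies in the domain of `A`. -/
def truncatedEnergy (A : H →ₗ.[ℂ] H) (n : ℕ) (ρ : H →L[ℂ] H) : ℝ :=
  (∑' i, inner ℂ (stdBasis H i)
    (applyOrZero A (spectralProjection A (Set.Icc 0 n) (ρ (stdBasis H i))))).re

/-- The energy `tr (A ρ) = sup_n tr (A 1_{[0,n]}(A) ρ) ∈ [0, ∞]` of the state `ρ` for the
positive Hamiltonian `A`. -/
def energy (A : H →ₗ.[ℂ] H) (ρ : H →L[ℂ] H) : ℝ≥0∞ :=
  ⨆ n : ℕ, ENNReal.ofReal (truncatedEnergy A n ρ)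

/-- `B` is the bounded, everywhere defined inverse of `A : dom A → H`. -/
def IsBoundedInverse (A : H →ₗ.[ℂ] H) (B : H →L[ℂ] H) : Prop :=
  (∀ x : A.domain, B (A x) = x) ∧ ∀ y : H, ∃ x : A.domain, A x = y

/-- `tr (A ^ (-s)) ∈ [0, ∞]` for `s > 0` and a positive definite Hamiltonian `A`. If `A` has a
bounded inverse (which is then unique), this is the trace of `(A⁻¹) ^ s`; otherwise `A ^ (-s)` is
unbounded, and its trace is `∞` (the infimum over the empty set). -/
def traceNegPow (A : H →ₗ.[ℂ] H) (s : ℝ) : ℝ≥0∞ :=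
  ⨅ (B : H →L[ℂ] H) (_ : IsBoundedInverse A B), posTrace (B ^ s)

end QuantumEntropy

end

open QuantumEntropy

open MeasureTheory
open scoped ENNReal

noncomputable section

namespace QuantumEntropy

variable {H : Type*} [NormedAddCommGroup H] [InnerProductSpace ℂ H] [CompleteSpace H]

/-! States, and differences of states, are compact and self-adjoint, so each has an orthonormal
eigenbasis, and traces of powers become sums over eigenvalues. The bridge between different
eigenbases is a Peierls inequality: the diagonal of an operator in any basis is its eigenvalue
sequence averaged by a doubly stochastic matrix, so by Jensen its `ℓ^p` norm is at most that of the
eigenvalues (`IsEigenbasis.tsum_abs_inner_rpow_le`). Minkowski's inequality for diagonals in the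
eigenbasis of `ρ` then gives the triangle inequality `IsState.schattenNorm_le_add`.

Schatten norms of states lie in `[0, 1]`, where `t ↦ t ^ α` is `α`-Lipschitz; this is the Tsallis
bound. Since `log` is `δ`-Lipschitz on `[δ⁻¹, ∞)`, the Rényi bound follows whenever both traces are
at least `δ⁻¹`. Without such a bound it fails: mixing a small weight `ε` on one vector into the
uniform state on `n` vectors moves it by at most `2 * ε`, but brings the entropy from `log n` down
below a bound independent of `n`.

Under the energy constraint, finiteness of `τ` makes the inverse of the Hamiltonian diagonalizable
with eigenvalues `c i > 0`. With `P i` the diagonal of `ρ` in that basis, the energy dominates `∑ P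
i / c i`, and two uses of Hölder turn `∑ P i = 1` into `1 ≤ δ * ∑ P i ^ α`. Peierls bounds the last
sum by `tr ρ ^ α`, so the first condition holds (`IsState.le_posTrace_rpow_of_energy_le`). -/

/-! ### Functional calculus and traces in an eigenbasis -/

open Filter Topology in
theorem cfc_apply_eigenvector {T : H →L[ℂ] H} (hT : IsSelfAdjoint T) {x : H} {c : ℝ}
    (h : T x = (c : ℂ) • x) {f : ℝ → ℝ} (hf : ContinuousOn f (spectrum ℝ T)) :
    cfc f T x = (f c : ℂ) • x := by
  rcases eq_or_ne x 0 with rfl | hx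
  · simp
  have hc : c ∈ spectrum ℝ T := by
    intro hu
    obtain ⟨u, hu⟩ := hu
    have h0 : (u : H →L[ℂ] H) x = 0 := by
      rw [hu]
      simp [h, Algebra.algebraMap_eq_smul_one]
    have h1 : ((↑u⁻¹ : H →L[ℂ] H) * (u : H →L[ℂ] H)) x = x := by simp
    rw [mul_apply_eq_comp, h0, map_zero] at h1
    exact hx h1.symm
  -- The identity is closed under sums, products and limits in `g`, so by Stone–Weierstrass it
  -- suffices to check constants and the identity function.
  have key : ∀ g : C(spectrum ℝ T, ℝ),
      cfcHom hT g x = ((g ⟨c, hc⟩ : ℝ) : ℂ) • x := by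
    intro g
    induction g using ContinuousMap.induction_on_of_compact with
    | const r =>
      have : (ContinuousMap.const (spectrum ℝ T) r) = algebraMap ℝ C(spectrum ℝ T, ℝ) r := rfl
      rw [this, AlgHomClass.commutes]
      simp [Algebra.algebraMap_eq_smul_one]
    | id => rw [cfcHom_id hT]; exact h
    | star_id => rw [map_star, cfcHom_id hT, hT.star_eq]; exact h
    | add f g hf hg => simp [hf, hg, add_smul]
    | mul f g hf hg =>
      rw [map_mul, mul_apply_eq_comp, hg, map_smul, hf, smul_smul, ContinuousMap.mul_apply,
        Complex.ofReal_mul, mul_comm]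
    | frequently f hf =>
      have hcl : IsClosed {g : C(spectrum ℝ T, ℝ) |
          cfcHom hT g x = ((g ⟨c, hc⟩ : ℝ) : ℂ) • x} := by
        refine isClosed_eq ?_ ?_
        · exact (ContinuousLinearMap.apply ℂ H x).continuous.comp (cfcHom_continuous hT)
        · fun_prop
      exact hcl.mem_of_frequently_of_tendsto hf tendsto_id
  rw [cfc_apply f T hT hf, key]
  rfl

theorem rpow_apply_eigenvector {T : H →L[ℂ] H} (hT : 0 ≤ T) {x : H} {c : ℝ}
    (h : T x = (c : ℂ) • x) {y : ℝ} (hy : 0 ≤ y) :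
    (T ^ y) x = ((c ^ y : ℝ) : ℂ) • x := by
  rw [CFC.rpow_eq_cfc_real hT]
  exact cfc_apply_eigenvector hT.isSelfAdjoint h (Real.continuous_rpow_const hy).continuousOn

theorem abs_apply_eigenvector {T : H →L[ℂ] H} (hT : IsSelfAdjoint T) {x : H} {c : ℝ}
    (h : T x = (c : ℂ) • x) : CFC.abs T x = ((|c| : ℝ) : ℂ) • x := by
  have h2 : (star T * T) x = ((c ^ 2 : ℝ) : ℂ) • x := by
    rw [hT.star_eq, mul_apply_eq_comp, h, map_smul, h, smul_smul]
    push_cast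
    rw [sq]
  rw [CFC.abs, CFC.sqrt_eq_rpow, rpow_apply_eigenvector (star_mul_self_nonneg T) h2 (by norm_num),
    ← Real.sqrt_eq_rpow, Real.sqrt_sq_eq_abs]

/-- The orthonormal basis `b` diagonalizes `T`, with eigenvalues `c`. -/
def IsEigenbasis {ι : Type*} (b : HilbertBasis ι ℂ H) (T : H →L[ℂ] H) (c : ι → ℝ) : Prop :=
  ∀ i, T (b i) = (c i : ℂ) • b i

omit [CompleteSpace H] in
theorem inner_eigenvector {ι : Type*} (b : HilbertBasis ι ℂ H) {T : H →L[ℂ] H} {i : ι} {c : ℝ}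
    (h : T (b i) = (c : ℂ) • b i) : inner ℂ (b i) (T (b i)) = (c : ℂ) := by
  rw [h, inner_smul_right, inner_self_eq_norm_sq_to_K, b.orthonormal.1 i]
  simp

theorem IsEigenbasis.posTrace {ι : Type*} {b : HilbertBasis ι ℂ H} {T : H →L[ℂ] H} {c : ι → ℝ}
    (h : IsEigenbasis b T c) (hT : 0 ≤ T) : posTrace T = ∑' i, ENNReal.ofReal (c i) := by
  rw [posTrace_eq_tsum b T ((ContinuousLinearMap.nonneg_iff_isPositive T).1 hT)]
  simp_rw [inner_eigenvector b (h _), Complex.ofReal_re]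

omit [CompleteSpace H] in
theorem IsEigenbasis.nonneg {ι : Type*} {b : HilbertBasis ι ℂ H} {T : H →L[ℂ] H} {c : ι → ℝ}
    (h : IsEigenbasis b T c) (hT : 0 ≤ T) (i : ι) : 0 ≤ c i := by
  have := ((ContinuousLinearMap.nonneg_iff_isPositive T).1 hT).re_inner_nonneg_right (b i)
  rw [inner_eigenvector b (h i)] at this
  simpa using this

theorem IsEigenbasis.rpow {ι : Type*} {b : HilbertBasis ι ℂ H} {T : H →L[ℂ] H} {c : ι → ℝ}
    (h : IsEigenbasis b T c) (hT : 0 ≤ T) {y : ℝ} (hy : 0 ≤ y) :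
    IsEigenbasis b (T ^ y) (fun i => c i ^ y) :=
  fun i => rpow_apply_eigenvector hT (h i) hy

theorem IsEigenbasis.abs {ι : Type*} {b : HilbertBasis ι ℂ H} {T : H →L[ℂ] H} {c : ι → ℝ}
    (h : IsEigenbasis b T c) (hT : IsSelfAdjoint T) :
    IsEigenbasis b (CFC.abs T) (fun i => |c i|) :=
  fun i => abs_apply_eigenvector hT (h i)

theorem IsEigenbasis.posTrace_rpow {ι : Type*} {b : HilbertBasis ι ℂ H} {T : H →L[ℂ] H}
    {c : ι → ℝ} (h : IsEigenbasis b T c) (hT : 0 ≤ T) {y : ℝ} (hy : 0 ≤ y) :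
    QuantumEntropy.posTrace (T ^ y) = ∑' i, ENNReal.ofReal (c i) ^ y := by
  rw [(h.rpow hT hy).posTrace CFC.rpow_nonneg]
  simp_rw [ENNReal.ofReal_rpow_of_nonneg (h.nonneg hT _) hy]

theorem IsEigenbasis.posTrace_abs_rpow {ι : Type*} {b : HilbertBasis ι ℂ H} {T : H →L[ℂ] H}
    {c : ι → ℝ} (h : IsEigenbasis b T c) (hT : IsSelfAdjoint T) {y : ℝ} (hy : 0 ≤ y) :
    QuantumEntropy.posTrace (CFC.abs T ^ y) = ∑' i, ENNReal.ofReal |c i| ^ y :=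
  (h.abs hT).posTrace_rpow (CFC.abs_nonneg T) hy

theorem IsEigenbasis.inner_eq {ι : Type*} {b : HilbertBasis ι ℂ H} {T : H →L[ℂ] H}
    {c : ι → ℝ} (h : IsEigenbasis b T c) (hT : IsSelfAdjoint T) (i : ι) (x : H) :
    inner ℂ (b i) (T x) = c i * inner ℂ (b i) x := by
  rw [← ContinuousLinearMap.adjoint_inner_left, hT.adjoint_eq, h i, inner_smul_left]
  simp

/-! ### Diagonalization of compact and of trace-class operators -/

theorem isSymmetric_of_isSelfAdjoint {T : H →L[ℂ] H} (hT : IsSelfAdjoint T) :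
    (T : H →ₗ[ℂ] H).IsSymmetric := fun x y => by
  have := ContinuousLinearMap.adjoint_inner_left T y x
  rwa [hT.adjoint_eq] at this

omit [CompleteSpace H] in
theorem inner_eq_zero_of_hilbertBasis {K : Submodule ℂ H} {ι : Type*} (e : HilbertBasis ι ℂ K)
    {x y : H} (h : ∀ i, inner ℂ (e i : H) x = 0) (hy : y ∈ K) : inner ℂ y x = 0 := by
  have h1 := ((e.hasSum_repr ⟨y, hy⟩).mapL K.subtypeL).mapL (innerSL ℂ x)
  have h3 : ∀ i, innerSL ℂ x (K.subtypeL (e.repr ⟨y, hy⟩ i • e i)) = 0 := by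
    intro i
    rw [map_smul, map_smul, innerSL_apply_apply, ← inner_conj_symm, Submodule.subtypeL_apply, h]
    simp
  simp_rw [h3] at h1
  have h4 := h1.unique hasSum_zero
  rw [← inner_conj_symm]
  simp only [innerSL_apply_apply, Submodule.subtypeL_apply] at h4
  simp [h4]

/-- A compact self-adjoint operator has an orthonormal basis of eigenvectors. -/
theorem exists_isEigenbasis_of_isCompactOperator.{u} {H : Type u} [NormedAddCommGroup H]
    [InnerProductSpace ℂ H] [CompleteSpace H] {T : H →L[ℂ] H} (hT : IsSelfAdjoint T)
    (hc : IsCompactOperator T) :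
    ∃ (ι : Type u) (b : HilbertBasis ι ℂ H) (c : ι → ℝ), IsEigenbasis b T c := by
  have hs : (T : H →ₗ[ℂ] H).IsSymmetric := isSymmetric_of_isSelfAdjoint hT
  let V : ℂ → Submodule ℂ H := fun μ => Module.End.eigenspace (T : Module.End ℂ H) μ
  have hcl : ∀ μ, IsClosed (V μ : Set H) := by
    intro μ
    have : (V μ : Set H) = {x | T x = μ • x} := by
      ext x
      exact Module.End.mem_eigenspace_iff
    rw [this]
    exact isClosed_eq T.continuous (continuous_const_smul μ)
  have : ∀ μ, CompleteSpace (V μ) := fun μ => (hcl μ).completeSpace_coe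
  choose w e he using fun μ => exists_hilbertBasis ℂ (V μ)
  have hV : OrthogonalFamily ℂ (fun μ => V μ) fun μ => (V μ).subtypeₗᵢ :=
    hs.orthogonalFamily_eigenspaces
  have ho : Orthonormal ℂ fun a : Σ μ, w μ => ((e a.1 a.2 : V a.1) : H) :=
    hV.orthonormal_sigma_orthonormal (fun μ => (e μ).orthonormal)
  have hbot : (Submodule.span ℂ (Set.range fun a : Σ μ, w μ => ((e a.1 a.2 : V a.1) : H)))ᗮ = ⊥ := by
    rw [eq_bot_iff, ← ContinuousLinearMap.orthogonalComplement_iSup_eigenspaces_eq_bot hc hs]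
    intro x hx
    rw [Submodule.mem_orthogonal] at hx
    have hx' : ∀ μ, ∀ y ∈ V μ, inner ℂ y x = 0 := by
      intro μ y hy
      exact inner_eq_zero_of_hilbertBasis (e μ)
        (fun i => hx _ (Submodule.subset_span ⟨⟨μ, i⟩, rfl⟩)) hy
    rw [Submodule.mem_orthogonal]
    intro y hy
    refine Submodule.iSup_induction (p := fun μ => V μ)
      (motive := fun y => inner ℂ y x = 0) hy hx' (by simp) ?_
    intro a b ha hb
    rw [inner_add_left, ha, hb, add_zero]
  let b := HilbertBasis.mkOfOrthogonalEqBot ho hbot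
  have hb : ∀ a : Σ μ, w μ, b a = ((e a.1 a.2 : V a.1) : H) := fun a => by
    rw [HilbertBasis.coe_mkOfOrthogonalEqBot]
  -- The basis is indexed over all complex `μ`, but an index carries a nonzero eigenvector, so by
  -- symmetry its `μ` is real.
  refine ⟨Σ μ, w μ, b, fun a => a.1.re, fun a => ?_⟩
  have hm : T (b a) = a.1 • b a := by
    have h1 : b a ∈ V a.1 := by
      rw [hb]
      exact (e a.1 a.2 : V a.1).2
    exact Module.End.mem_eigenspace_iff.1 h1
  have hconj : (starRingEnd ℂ) a.1 = a.1 :=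
    hs.conj_eigenvalue_eq_self (Module.End.hasEigenvalue_of_hasEigenvector
      ⟨Module.End.mem_eigenspace_iff.2 hm, b.orthonormal.ne_zero a⟩)
  rw [hm, Complex.conj_eq_iff_re.1 hconj]

open Filter Topology in
/-- A positive operator with finite trace is compact. -/
theorem isCompactOperator_of_posTrace_ne_top {T : H →L[ℂ] H} (hT : 0 ≤ T)
    (h : posTrace T ≠ ∞) : IsCompactOperator T := by
  classical
  set R := CFC.sqrt T with hR
  have hRs : IsSelfAdjoint R := (CFC.sqrt_nonneg T).isSelfAdjoint
  have hTR : T = R * R := (CFC.sqrt_mul_sqrt_self T hT).symm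
  set b := stdBasis H
  have key : ∀ x, (inner ℂ x (T x)).re = ‖R x‖ ^ 2 := by
    intro x
    rw [hTR, mul_apply_eq_comp, ← ContinuousLinearMap.adjoint_inner_left,
      hRs.adjoint_eq, inner_self_eq_norm_sq_to_K]
    norm_cast
  have hsum : Summable fun i => ‖R (b i)‖ ^ 2 := by
    have := ENNReal.summable_toReal h
    simp_rw [key] at this
    simpa using this
  -- The square root `R` is Hilbert–Schmidt, as `‖R (b i)‖ ^ 2` is the diagonal of `T`. Hence it is
  -- the norm limit of its finite-rank truncations `F s`, the error being a tail controlled by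
  -- Cauchy–Schwarz and Bessel.
  let F : Finset (BasisIndex H) → H →L[ℂ] H := fun s =>
    ∑ i ∈ s, (innerSL ℂ (b i)).smulRight (R (b i))
  have hF : ∀ s, IsCompactOperator (F s) := by
    intro s
    have hmem : F s ∈ compactOperator (RingHom.id ℂ) H H := by
      refine Submodule.sum_mem _ fun i _ => ?_
      change IsCompactOperator _
      have h1 : IsCompactOperator ((ContinuousLinearMap.id ℂ ℂ).smulRight (R (b i))) :=
        isCompactOperator_of_locallyCompactSpace_rng _
      exact h1.comp_clm (innerSL ℂ (b i))
    exact hmem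
  have hlim : Tendsto F atTop (𝓝 R) := by
    rw [Metric.tendsto_nhds]
    intro ε hε
    have ht := hsum.hasSum
    have hε2 : 0 < (ε / 2) ^ 2 := by positivity
    filter_upwards [(tendsto_order.1 ht).1 (∑' i, ‖R (b i)‖ ^ 2 - (ε / 2) ^ 2) (by linarith)]
      with s hs
    refine lt_of_le_of_lt ?_ (half_lt_self hε)
    rw [dist_comm, dist_eq_norm]
    refine ContinuousLinearMap.opNorm_le_bound _ (by positivity) fun x => ?_
    have h1 : HasSum (fun i => inner ℂ (b i) x • R (b i)) (R x) := by
      have := (b.hasSum_repr x).mapL R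
      simpa [b.repr_apply_apply] using this
    have h2 : Tendsto (fun t => ∑ i ∈ t \ s, inner ℂ (b i) x • R (b i)) atTop
        (𝓝 ((R - F s) x)) := by
      have h3 : Tendsto (fun t => ∑ i ∈ t, inner ℂ (b i) x • R (b i) -
          ∑ i ∈ s, inner ℂ (b i) x • R (b i)) atTop (𝓝 ((R - F s) x)) := by
        have : (R - F s) x = R x - ∑ i ∈ s, inner ℂ (b i) x • R (b i) := by
          simp [F, sum_apply]
        rw [this]
        exact h1.sub_const _
      refine h3.congr' ?_
      filter_upwards [eventually_ge_atTop s] with t hst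
      rw [← Finset.sum_sdiff hst, add_sub_cancel_right]
    refine le_of_tendsto h2.norm ?_
    filter_upwards [eventually_ge_atTop s] with t hst
    have hbessel : ∑ i ∈ t \ s, ‖inner ℂ (b i) x‖ ^ 2 ≤ ‖x‖ ^ 2 :=
      b.orthonormal.sum_inner_products_le x
    have htail : ∑ i ∈ t \ s, ‖R (b i)‖ ^ 2 ≤ (ε / 2) ^ 2 := by
      have h4 : ∑ i ∈ t, ‖R (b i)‖ ^ 2 ≤ ∑' i, ‖R (b i)‖ ^ 2 :=
        hsum.sum_le_tsum t (fun i _ => by positivity)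
      rw [← Finset.sum_sdiff hst] at h4
      linarith
    calc ‖∑ i ∈ t \ s, inner ℂ (b i) x • R (b i)‖
        ≤ ∑ i ∈ t \ s, ‖inner ℂ (b i) x‖ * ‖R (b i)‖ := by
          refine (norm_sum_le _ _).trans (Finset.sum_le_sum fun i _ => ?_)
          rw [norm_smul]
      _ ≤ √(∑ i ∈ t \ s, ‖inner ℂ (b i) x‖ ^ 2) * √(∑ i ∈ t \ s, ‖R (b i)‖ ^ 2) :=
          Real.sum_mul_le_sqrt_mul_sqrt _ _ _
      _ ≤ √(‖x‖ ^ 2) * √((ε / 2) ^ 2) := by gcongr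
      _ = ε / 2 * ‖x‖ := by
          rw [Real.sqrt_sq (norm_nonneg x), Real.sqrt_sq (by positivity), mul_comm]
  have hRc : IsCompactOperator R := isCompactOperator_of_tendsto hlim (.of_forall hF)
  rw [hTR]
  exact hRc.clm_comp R

/-! ### Inequalities for sums and the Peierls inequality -/

theorem tsum_mul_le_Lp_mul_Lq {ι : Type*} {p q : ℝ} (hpq : p.HolderConjugate q)
    (f g : ι → ℝ≥0∞) :
    ∑' i, f i * g i ≤ (∑' i, f i ^ p) ^ (1 / p) * (∑' i, g i ^ q) ^ (1 / q) := by
  let _ : MeasurableSpace ι := ⊤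
  have := ENNReal.lintegral_mul_le_Lp_mul_Lq Measure.count hpq
    (f := f) (g := g) (measurable_from_top.aemeasurable) (measurable_from_top.aemeasurable)
  simpa [lintegral_count] using this

theorem tsum_Lp_add_le {ι : Type*} {p : ℝ} (hp : 1 ≤ p) (f g : ι → ℝ≥0∞) :
    (∑' i, (f i + g i) ^ p) ^ (1 / p) ≤
      (∑' i, f i ^ p) ^ (1 / p) + (∑' i, g i ^ p) ^ (1 / p) := by
  let _ : MeasurableSpace ι := ⊤
  have := ENNReal.lintegral_Lp_add_le (μ := Measure.count)
    (f := f) (g := g) (measurable_from_top.aemeasurable) (measurable_from_top.aemeasurable) hp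
  simpa [lintegral_count] using this

/-- Jensen's inequality for `t ↦ t ^ p`, obtained from Hölder by splitting the weight as `w ^ (1 /
p) * w ^ (1 / q)`. -/
theorem tsum_mul_rpow_le_tsum_mul_rpow {ι : Type*} {p : ℝ} (hp : 1 ≤ p) (w a : ι → ℝ≥0∞)
    (hw : ∑' i, w i = 1) : (∑' i, w i * a i) ^ p ≤ ∑' i, w i * a i ^ p := by
  rcases hp.eq_or_lt with rfl | hp1
  · simp
  have hpq := Real.HolderConjugate.conjExponent hp1
  set q := p.conjExponent
  have hp0 : 0 < p := by linarith
  have h := tsum_mul_le_Lp_mul_Lq hpq (fun i => w i ^ (1 / p) * a i) (fun i => w i ^ (1 / q))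
  have hwt : ∀ i, w i ≠ ∞ := fun i => ne_top_of_le_ne_top (by simp [hw]) (ENNReal.le_tsum i)
  have e1 : ∀ i, w i ^ (1 / p) * a i * w i ^ (1 / q) = w i * a i := by
    intro i
    rw [mul_right_comm, ← ENNReal.rpow_add_of_nonneg _ _ (by positivity)
      (one_div_nonneg.2 hpq.symm.nonneg), one_div, one_div, hpq.inv_add_inv_eq_one,
      ENNReal.rpow_one]
  have e2 : ∀ i, (w i ^ (1 / p) * a i) ^ p = w i * a i ^ p := by
    intro i
    rw [ENNReal.mul_rpow_of_nonneg _ _ hp0.le, ← ENNReal.rpow_mul, one_div_mul_cancel hp0.ne',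
      ENNReal.rpow_one]
  have e3 : ∀ i, (w i ^ (1 / q)) ^ q = w i := by
    intro i
    rw [← ENNReal.rpow_mul, one_div_mul_cancel hpq.symm.ne_zero, ENNReal.rpow_one]
  simp_rw [e1, e2, e3, hw, ENNReal.one_rpow, mul_one] at h
  calc _ ≤ ((∑' i, w i * a i ^ p) ^ (1 / p)) ^ p := ENNReal.rpow_le_rpow h hp0.le
    _ = _ := by rw [← ENNReal.rpow_mul, one_div_mul_cancel hp0.ne', ENNReal.rpow_one]

theorem IsEigenbasis.hasSum_inner {ι : Type*} {b : HilbertBasis ι ℂ H} {T : H →L[ℂ] H}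
    {c : ι → ℝ} (h : IsEigenbasis b T c) (hT : IsSelfAdjoint T) (x : H) :
    HasSum (fun i => c i * ‖inner ℂ (b i) x‖ ^ 2) (inner ℂ x (T x)).re := by
  have h1 := Complex.hasSum_re (b.hasSum_inner_mul_inner x (T x))
  refine h1.congr_fun fun i => ?_
  rw [h.inner_eq hT, mul_left_comm, Complex.re_ofReal_mul, ← inner_conj_symm x,
    mul_comm (starRingEnd ℂ _), Complex.mul_conj, Complex.ofReal_re, Complex.normSq_eq_norm_sq]

/-- The diagonal of a self-adjoint operator in any orthonormal basis is dominated, in the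
`ℓ ^ p` norm, by the sequence of eigenvalues. -/
theorem IsEigenbasis.tsum_abs_inner_rpow_le {ι κ : Type*} {b : HilbertBasis ι ℂ H}
    {T : H →L[ℂ] H} {c : ι → ℝ} (h : IsEigenbasis b T c) (hT : IsSelfAdjoint T)
    (g : HilbertBasis κ ℂ H) {p : ℝ} (hp : 1 ≤ p) :
    ∑' k, ENNReal.ofReal |(inner ℂ (g k) (T (g k))).re| ^ p ≤
      ∑' i, ENNReal.ofReal |c i| ^ p := by
  -- By Parseval in each basis this matrix is doubly stochastic: row sums feed Jensen, column sums
  -- evaluate the double sum.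
  let w : κ → ι → ℝ≥0∞ := fun k i => ENNReal.ofReal (‖inner ℂ (b i) (g k)‖ ^ 2)
  have hw1 : ∀ k, ∑' i, w k i = 1 := fun k => by
    rw [tsum_ofReal_norm_inner_sq, g.orthonormal.1]; simp
  have hw2 : ∀ i, ∑' k, w k i = 1 := fun i => by
    simp_rw [w, norm_inner_symm (b i)]
    rw [tsum_ofReal_norm_inner_sq, b.orthonormal.1]; simp
  calc _ ≤ ∑' k, (∑' i, w k i * ENNReal.ofReal |c i|) ^ p := by
        refine ENNReal.tsum_le_tsum fun k => ENNReal.rpow_le_rpow ?_ (by linarith)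
        rw [← (h.hasSum_inner hT (g k)).tsum_eq, ← Real.enorm_eq_ofReal_abs]
        refine enorm_tsum_le_tsum_enorm.trans (ENNReal.tsum_le_tsum fun i => ?_)
        rw [enorm_mul, mul_comm, Real.enorm_eq_ofReal_abs, Real.enorm_eq_ofReal_abs,
          abs_of_nonneg (sq_nonneg _)]
    _ ≤ ∑' k, ∑' i, w k i * ENNReal.ofReal |c i| ^ p :=
        ENNReal.tsum_le_tsum fun k => tsum_mul_rpow_le_tsum_mul_rpow hp _ _ (hw1 k)
    _ = _ := by
        rw [ENNReal.tsum_comm]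
        simp_rw [ENNReal.tsum_mul_right, hw2, one_mul]

/-! ### Schatten norms of states -/

theorem IsState.nonneg {ρ : H →L[ℂ] H} (h : IsState ρ) : 0 ≤ ρ :=
  (ContinuousLinearMap.nonneg_iff_isPositive ρ).2 h.isPositive

theorem IsState.isCompactOperator {ρ : H →L[ℂ] H} (h : IsState ρ) : IsCompactOperator ρ :=
  isCompactOperator_of_posTrace_ne_top h.nonneg (by simp [h.posTrace_eq_one])

theorem IsState.exists_isEigenbasis.{u} {H : Type u} [NormedAddCommGroup H]
    [InnerProductSpace ℂ H] [CompleteSpace H] {ρ : H →L[ℂ] H} (h : IsState ρ) :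
    ∃ (ι : Type u) (b : HilbertBasis ι ℂ H) (c : ι → ℝ), IsEigenbasis b ρ c :=
  exists_isEigenbasis_of_isCompactOperator h.nonneg.isSelfAdjoint h.isCompactOperator

theorem IsState.exists_isEigenbasis_sub.{u} {H : Type u} [NormedAddCommGroup H]
    [InnerProductSpace ℂ H] [CompleteSpace H] {ρ σ : H →L[ℂ] H} (hρ : IsState ρ)
    (hσ : IsState σ) :
    ∃ (ι : Type u) (b : HilbertBasis ι ℂ H) (c : ι → ℝ), IsEigenbasis b (ρ - σ) c :=
  exists_isEigenbasis_of_isCompactOperator (hρ.nonneg.isSelfAdjoint.sub hσ.nonneg.isSelfAdjoint)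
    (hρ.isCompactOperator.sub hσ.isCompactOperator)

theorem IsState.tsum_inner {ι : Type*} {ρ : H →L[ℂ] H} (h : IsState ρ)
    (b : HilbertBasis ι ℂ H) : ∑' i, ENNReal.ofReal (inner ℂ (b i) (ρ (b i))).re = 1 := by
  rw [← posTrace_eq_tsum b ρ h.isPositive, h.posTrace_eq_one]

theorem IsState.inner_nonneg {ρ : H →L[ℂ] H} (h : IsState ρ) (x : H) :
    0 ≤ (inner ℂ x (ρ x)).re :=
  h.isPositive.re_inner_nonneg_right x

theorem IsState.inner_le_one {ι : Type*} {ρ : H →L[ℂ] H} (h : IsState ρ)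
    (b : HilbertBasis ι ℂ H) (i : ι) : (inner ℂ (b i) (ρ (b i))).re ≤ 1 := by
  have := ENNReal.le_tsum (f := fun i => ENNReal.ofReal (inner ℂ (b i) (ρ (b i))).re) i
  rw [h.tsum_inner b] at this
  simpa using this

theorem IsState.posTrace_rpow_le_one {ρ : H →L[ℂ] H} (h : IsState ρ) {p : ℝ} (hp : 1 ≤ p) :
    posTrace (ρ ^ p) ≤ 1 := by
  obtain ⟨ι, b, c, hc⟩ := h.exists_isEigenbasis
  rw [hc.posTrace_rpow h.nonneg (by linarith), ← h.posTrace_eq_one, hc.posTrace h.nonneg]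
  refine ENNReal.tsum_le_tsum fun i => ?_
  have := h.inner_le_one b i
  rw [inner_eigenvector b (hc i), Complex.ofReal_re] at this
  exact ENNReal.rpow_le_self_of_le_one (by simpa using this) hp

theorem IsState.posTrace_rpow_pos {ρ : H →L[ℂ] H} (h : IsState ρ) {p : ℝ} (hp : 1 ≤ p) :
    0 < posTrace (ρ ^ p) := by
  obtain ⟨ι, b, c, hc⟩ := h.exists_isEigenbasis
  have h1 := h.posTrace_eq_one
  rw [hc.posTrace h.nonneg] at h1
  rw [hc.posTrace_rpow h.nonneg (by linarith), pos_iff_ne_zero]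
  intro h0
  rw [ENNReal.tsum_eq_zero] at h0
  have : ∀ i, ENNReal.ofReal (c i) = 0 := fun i => by
    rcases ENNReal.rpow_eq_zero_iff.1 (h0 i) with h2 | h2
    · exact h2.1
    · linarith [h2.2]
  simp_rw [this] at h1
  simp at h1

/-- Each eigenvalue of `ρ - σ` is a difference of two diagonal entries in `[0, 1]`, so its `p`-th
power is at most the sum of these entries, and the total is at most `2`. -/
theorem IsState.memSchatten_sub {ρ σ : H →L[ℂ] H} (hρ : IsState ρ) (hσ : IsState σ) {p : ℝ}
    (hp : 1 ≤ p) : MemSchatten p (ρ - σ) := by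
  obtain ⟨ι, b, c, hc⟩ := hρ.exists_isEigenbasis_sub hσ
  rw [MemSchatten, hc.posTrace_abs_rpow (hρ.nonneg.isSelfAdjoint.sub hσ.nonneg.isSelfAdjoint)
    (by linarith)]
  have hci : ∀ i, c i = (inner ℂ (b i) (ρ (b i))).re - (inner ℂ (b i) (σ (b i))).re := by
    intro i
    have := inner_eigenvector b (hc i)
    rw [sub_apply, inner_sub_right] at this
    rw [← Complex.sub_re, this, Complex.ofReal_re]
  have h1 : ∀ i, |c i| ≤ 1 := fun i => by
    rw [hci, abs_le]
    constructor <;> linarith [hρ.inner_nonneg (b i), hσ.inner_nonneg (b i), hρ.inner_le_one b i,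
      hσ.inner_le_one b i]
  have h2 : ∀ i, |c i| ≤ (inner ℂ (b i) (ρ (b i))).re + (inner ℂ (b i) (σ (b i))).re :=
    fun i => by
      rw [hci, abs_le]
      constructor <;> linarith [hρ.inner_nonneg (b i), hσ.inner_nonneg (b i)]
  calc ∑' i, ENNReal.ofReal |c i| ^ p
      ≤ ∑' i, (ENNReal.ofReal (inner ℂ (b i) (ρ (b i))).re +
          ENNReal.ofReal (inner ℂ (b i) (σ (b i))).re) := by
        refine ENNReal.tsum_le_tsum fun i => ?_
        refine (ENNReal.rpow_le_self_of_le_one (by simpa using h1 i) hp).trans ?_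
        rw [← ENNReal.ofReal_add (hρ.inner_nonneg _) (hσ.inner_nonneg _)]
        exact ENNReal.ofReal_le_ofReal (h2 i)
    _ < ∞ := by
        rw [ENNReal.tsum_add, hρ.tsum_inner, hσ.tsum_inner]
        simp

theorem schattenNorm_nonneg (p : ℝ) (T : H →L[ℂ] H) : 0 ≤ schattenNorm p T :=
  Real.rpow_nonneg ENNReal.toReal_nonneg _

theorem IsState.schattenNorm_rpow {ρ : H →L[ℂ] H} (h : IsState ρ) {p : ℝ} (hp : 1 ≤ p) :
    schattenNorm p ρ ^ p = (posTrace (ρ ^ p)).toReal := by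
  rw [schattenNorm, CFC.abs_of_nonneg ρ h.nonneg, ← Real.rpow_mul ENNReal.toReal_nonneg,
    one_div_mul_cancel (by linarith), Real.rpow_one]

theorem IsState.schattenNorm_le_one {ρ : H →L[ℂ] H} (h : IsState ρ) {p : ℝ} (hp : 1 ≤ p) :
    schattenNorm p ρ ≤ 1 := by
  rw [schattenNorm, CFC.abs_of_nonneg ρ h.nonneg]
  refine Real.rpow_le_one ENNReal.toReal_nonneg ?_ (by positivity)
  exact ENNReal.toReal_le_of_le_ofReal zero_le_one (by simpa using h.posTrace_rpow_le_one hp)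

/-- The diagonal of a positive operator is majorized by its eigenvalues (Peierls inequality). -/
theorem IsState.tsum_inner_rpow_le {ι : Type*} {ρ : H →L[ℂ] H} (h : IsState ρ)
    (b : HilbertBasis ι ℂ H) {p : ℝ} (hp : 1 ≤ p) :
    ∑' i, ENNReal.ofReal (inner ℂ (b i) (ρ (b i))).re ^ p ≤ posTrace (ρ ^ p) := by
  obtain ⟨κ, e, c, hc⟩ := h.exists_isEigenbasis
  have h1 := hc.tsum_abs_inner_rpow_le h.nonneg.isSelfAdjoint b hp
  rw [hc.posTrace_rpow h.nonneg (by linarith)]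
  simpa only [abs_of_nonneg (h.inner_nonneg _), abs_of_nonneg (hc.nonneg h.nonneg _)] using h1

/-- The reverse triangle inequality for the Schatten norm of states. -/
theorem IsState.schattenNorm_le_add {ρ σ : H →L[ℂ] H} (hρ : IsState ρ) (hσ : IsState σ) {p : ℝ}
    (hp : 1 ≤ p) : schattenNorm p ρ ≤ schattenNorm p σ + schattenNorm p (ρ - σ) := by
  obtain ⟨ι, b, c, hc⟩ := hρ.exists_isEigenbasis
  obtain ⟨κ, e, d, hd⟩ := hρ.exists_isEigenbasis_sub hσ
  have hsa := hρ.nonneg.isSelfAdjoint.sub hσ.nonneg.isSelfAdjoint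
  have h1 := hd.tsum_abs_inner_rpow_le hsa b hp
  rw [← hd.posTrace_abs_rpow hsa (by linarith)] at h1
  have h2 := hσ.tsum_inner_rpow_le b hp
  have hp0 : 0 ≤ 1 / p := by positivity
  have hm : posTrace (CFC.abs (ρ - σ) ^ p) ≠ ∞ := (hρ.memSchatten_sub hσ hp).ne
  have hs : posTrace (σ ^ p) ≠ ∞ := ne_top_of_le_ne_top (by simp) (hσ.posTrace_rpow_le_one hp)
  -- In the eigenbasis of `ρ`, each eigenvalue is the sum of the diagonal entries of `σ` and `ρ -
  -- σ`. Minkowski separates them and Peierls bounds each part.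
  have h3 : posTrace (ρ ^ p) ^ (1 / p) ≤
      posTrace (σ ^ p) ^ (1 / p) + posTrace (CFC.abs (ρ - σ) ^ p) ^ (1 / p) := by
    rw [hc.posTrace_rpow hρ.nonneg (by linarith)]
    calc _ ≤ (∑' i, (ENNReal.ofReal (inner ℂ (b i) (σ (b i))).re +
            ENNReal.ofReal |(inner ℂ (b i) ((ρ - σ) (b i))).re|) ^ p) ^ (1 / p) := by
          refine ENNReal.rpow_le_rpow (ENNReal.tsum_le_tsum fun i =>
            ENNReal.rpow_le_rpow ?_ (by linarith)) hp0
          rw [← ENNReal.ofReal_add (hσ.inner_nonneg _) (abs_nonneg _)]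
          refine ENNReal.ofReal_le_ofReal ?_
          have h4 : c i = (inner ℂ (b i) (ρ (b i))).re := by
            rw [inner_eigenvector b (hc i), Complex.ofReal_re]
          rw [sub_apply, inner_sub_right, Complex.sub_re, ← h4]
          linarith [le_abs_self (c i - (inner ℂ (b i) (σ (b i))).re)]
      _ ≤ _ := tsum_Lp_add_le hp _ _
      _ ≤ _ := add_le_add (ENNReal.rpow_le_rpow h2 hp0) (ENNReal.rpow_le_rpow h1 hp0)
  have h5 := ENNReal.toReal_mono (ENNReal.add_ne_top.2
    ⟨ENNReal.rpow_ne_top_of_nonneg hp0 hs, ENNReal.rpow_ne_top_of_nonneg hp0 hm⟩) h3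
  rw [ENNReal.toReal_add (ENNReal.rpow_ne_top_of_nonneg hp0 hs)
    (ENNReal.rpow_ne_top_of_nonneg hp0 hm), ← ENNReal.toReal_rpow, ← ENNReal.toReal_rpow,
    ← ENNReal.toReal_rpow] at h5
  simpa only [schattenNorm, CFC.abs_of_nonneg ρ hρ.nonneg, CFC.abs_of_nonneg σ hσ.nonneg] using h5

/-! ### Lipschitz estimates for the entropies -/

theorem schattenNorm_sub_comm (p : ℝ) (S T : H →L[ℂ] H) :
    schattenNorm p (S - T) = schattenNorm p (T - S) := by
  rw [schattenNorm, ← neg_sub, CFC.abs_neg, schattenNorm]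

/-- Bernoulli's inequality for `(b / a) ^ p`, multiplied by `a ^ p`, together with `a ^ p ≤ a`. -/
theorem rpow_sub_rpow_le {a b p : ℝ} (hb : 0 ≤ b) (hba : b ≤ a) (ha : a ≤ 1) (hp : 1 ≤ p) :
    a ^ p - b ^ p ≤ p * (a - b) := by
  rcases (hb.trans hba).eq_or_lt with rfl | ha0
  · obtain rfl : b = 0 := le_antisymm hba hb
    simp
  have h1 := one_add_mul_self_le_rpow_one_add (s := b / a - 1)
    (by linarith [div_nonneg hb ha0.le]) hp
  rw [add_sub_cancel, Real.div_rpow hb ha0.le, le_div_iff₀ (by positivity)] at h1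
  have h2 : a ^ p ≤ a := by
    simpa using Real.rpow_le_rpow_of_exponent_ge ha0 ha hp
  have h3 : 0 ≤ 1 - b / a := by
    rw [sub_nonneg, div_le_one ha0]; exact hba
  have h4 : a ^ p * (p * (1 - b / a)) ≤ a * (p * (1 - b / a)) := by gcongr
  have h5 : a * (p * (1 - b / a)) = p * (a - b) := by field_simp
  nlinarith

theorem IsState.abs_schattenNorm_rpow_sub_le {ρ σ : H →L[ℂ] H} (hρ : IsState ρ) (hσ : IsState σ)
    {p : ℝ} (hp : 1 ≤ p) :
    |schattenNorm p ρ ^ p - schattenNorm p σ ^ p| ≤ p * schattenNorm p (ρ - σ) := by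
  wlog h : schattenNorm p σ ≤ schattenNorm p ρ generalizing ρ σ
  · rw [abs_sub_comm, schattenNorm_sub_comm]
    exact this hσ hρ (not_le.1 h).le
  have hmono := Real.rpow_le_rpow (schattenNorm_nonneg _ _) h (by linarith : 0 ≤ p)
  rw [abs_of_nonneg (by linarith)]
  refine (rpow_sub_rpow_le (schattenNorm_nonneg _ _) h (hρ.schattenNorm_le_one hp) hp).trans ?_
  gcongr
  linarith [hρ.schattenNorm_le_add hσ hp]

theorem abs_log_sub_log_le {a b δ : ℝ} (hδ : 0 < δ) (ha : δ⁻¹ ≤ a) (hb : δ⁻¹ ≤ b) :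
    |Real.log a - Real.log b| ≤ δ * |a - b| := by
  wlog h : b ≤ a generalizing a b
  · rw [abs_sub_comm, abs_sub_comm a]
    exact this hb ha (not_le.1 h).le
  have hd : 0 < δ⁻¹ := by positivity
  have hb0 : 0 < b := hd.trans_le hb
  have ha0 : 0 < a := hd.trans_le ha
  rw [abs_of_nonneg (sub_nonneg.2 (Real.log_le_log hb0 h)), abs_of_nonneg (sub_nonneg.2 h),
    ← Real.log_div ha0.ne' hb0.ne']
  refine (Real.log_le_sub_one_of_pos (by positivity)).trans ?_
  have : a / b - 1 = b⁻¹ * (a - b) := by field_simp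
  rw [this]
  exact mul_le_mul_of_nonneg_right (inv_le_of_inv_le₀ hδ hb) (sub_nonneg.2 h)

theorem IsState.abs_renyiEntropy_sub_le {ρ σ : H →L[ℂ] H} (hρ : IsState ρ) (hσ : IsState σ)
    {α : ℝ} (hα : 1 < α) {δ : ℝ} (hδ : 0 < δ) (h1 : δ⁻¹ ≤ (posTrace (ρ ^ α)).toReal)
    (h2 : δ⁻¹ ≤ (posTrace (σ ^ α)).toReal) :
    |renyiEntropy α ρ - renyiEntropy α σ| ≤ α * δ / (α - 1) * schattenNorm α (ρ - σ) := by
  have h3 := abs_log_sub_log_le hδ h1 h2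
  have h4 := hρ.abs_schattenNorm_rpow_sub_le hσ hα.le
  rw [hρ.schattenNorm_rpow hα.le, hσ.schattenNorm_rpow hα.le] at h4
  rw [renyiEntropy, renyiEntropy, ← sub_div, abs_div, abs_sub_comm 1, abs_of_pos (sub_pos.2 hα),
    div_mul_eq_mul_div]
  refine div_le_div_of_nonneg_right ?_ (by linarith)
  nlinarith [mul_le_mul_of_nonneg_left h4 hδ.le]

theorem IsState.abs_tsallisEntropy_sub_eq {ρ σ : H →L[ℂ] H} (hρ : IsState ρ) (hσ : IsState σ)
    {α : ℝ} (hα : 1 < α) : |tsallisEntropy α ρ - tsallisEntropy α σ| =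
      |schattenNorm α ρ ^ α - schattenNorm α σ ^ α| / (α - 1) := by
  rw [tsallisEntropy, tsallisEntropy, ← sub_div, abs_div, abs_sub_comm 1,
    abs_of_pos (sub_pos.2 hα), sub_sub_sub_cancel_right, hρ.schattenNorm_rpow hα.le,
    hσ.schattenNorm_rpow hα.le]

/-! ### Finite-rank diagonal states and failure of uniform continuity -/

omit [CompleteSpace H] in
theorem isPositive_of_inner_eq {T : H →L[ℂ] H} {f : H → ℝ} (hf : ∀ x, 0 ≤ f x)
    (h : ∀ x, inner ℂ (T x) x = (f x : ℂ)) : T.IsPositive := by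
  rw [ContinuousLinearMap.isPositive_iff_complex]
  intro x
  rw [h]
  simpa using hf x

/-- The finite-rank operator `∑ i ∈ s, c i |b i⟩⟨b i|`. -/
def diagOp {ι : Type*} (b : HilbertBasis ι ℂ H) (s : Finset ι) (c : ι → ℝ) : H →L[ℂ] H :=
  ∑ i ∈ s, (c i : ℂ) • (innerSL ℂ (b i)).smulRight (b i)

omit [CompleteSpace H] in
theorem diagOp_apply {ι : Type*} (b : HilbertBasis ι ℂ H) (s : Finset ι) (c : ι → ℝ) (x : H) :
    diagOp b s c x = ∑ i ∈ s, (c i : ℂ) • inner ℂ (b i) x • b i := by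
  simp [diagOp, sum_apply]

open Classical in
omit [CompleteSpace H] in
theorem isEigenbasis_diagOp {ι : Type*} (b : HilbertBasis ι ℂ H) (s : Finset ι) (c : ι → ℝ) :
    IsEigenbasis b (diagOp b s c) (fun i => if i ∈ s then c i else 0) := by
  intro j
  have h : ∀ i, (c i : ℂ) • inner ℂ (b i) (b j) • b i = if j = i then (c i : ℂ) • b i else 0 := by
    intro i
    rw [orthonormal_iff_ite.1 b.orthonormal]
    by_cases h : i = j
    · simp [h]
    · simp [h, Ne.symm h]
  simp_rw [diagOp_apply, h, Finset.sum_ite_eq]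
  split_ifs <;> simp

omit [CompleteSpace H] in
theorem diagOp_nonneg {ι : Type*} (b : HilbertBasis ι ℂ H) (s : Finset ι) {c : ι → ℝ}
    (hc : ∀ i ∈ s, 0 ≤ c i) : 0 ≤ diagOp b s c := by
  rw [ContinuousLinearMap.nonneg_iff_isPositive]
  refine isPositive_of_inner_eq (f := fun x => ∑ i ∈ s, c i * ‖inner ℂ (b i) x‖ ^ 2)
    (fun x => Finset.sum_nonneg fun i hi => mul_nonneg (hc i hi) (sq_nonneg _)) fun x => ?_
  rw [diagOp_apply, sum_inner]
  push_cast
  refine Finset.sum_congr rfl fun i _ => ?_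
  rw [inner_smul_left, inner_smul_left, Complex.conj_ofReal, Complex.conj_mul']

theorem posTrace_diagOp {ι : Type*} (b : HilbertBasis ι ℂ H) (s : Finset ι) {c : ι → ℝ}
    (hc : ∀ i ∈ s, 0 ≤ c i) : posTrace (diagOp b s c) = ENNReal.ofReal (∑ i ∈ s, c i) := by
  classical
  rw [(isEigenbasis_diagOp b s c).posTrace (diagOp_nonneg b s hc),
    tsum_eq_sum (s := s) (by intro i hi; simp [hi]), ENNReal.ofReal_sum_of_nonneg hc]
  exact Finset.sum_congr rfl fun i hi => by simp [hi]

theorem toReal_tsum_ofReal_ite_rpow {ι : Type*} [DecidableEq ι] (s : Finset ι) {c : ι → ℝ}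
    (hc : ∀ i ∈ s, 0 ≤ c i) {p : ℝ} (hp : 0 < p) :
    (∑' i, ENNReal.ofReal (if i ∈ s then c i else 0) ^ p).toReal = ∑ i ∈ s, c i ^ p := by
  rw [tsum_eq_sum (s := s) (by intro i hi; simp [hi, hp]), ENNReal.toReal_sum (by
    intro i _; exact ENNReal.rpow_ne_top_of_nonneg hp.le ENNReal.ofReal_ne_top)]
  refine Finset.sum_congr rfl fun i hi => ?_
  rw [if_pos hi, ← ENNReal.toReal_rpow, ENNReal.toReal_ofReal (hc i hi)]

theorem toReal_posTrace_diagOp_rpow {ι : Type*} (b : HilbertBasis ι ℂ H) (s : Finset ι)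
    {c : ι → ℝ} (hc : ∀ i ∈ s, 0 ≤ c i) {p : ℝ} (hp : 0 < p) :
    (posTrace (diagOp b s c ^ p)).toReal = ∑ i ∈ s, c i ^ p := by
  classical
  rw [(isEigenbasis_diagOp b s c).posTrace_rpow (diagOp_nonneg b s hc) hp.le,
    toReal_tsum_ofReal_ite_rpow s hc hp]

theorem schattenNorm_diagOp_sub {ι : Type*} (b : HilbertBasis ι ℂ H) (s : Finset ι)
    {c d : ι → ℝ} (hc : ∀ i ∈ s, 0 ≤ c i) (hd : ∀ i ∈ s, 0 ≤ d i) {p : ℝ} (hp : 0 < p) :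
    schattenNorm p (diagOp b s c - diagOp b s d) = (∑ i ∈ s, |c i - d i| ^ p) ^ (1 / p) := by
  classical
  have h : IsEigenbasis b (diagOp b s c - diagOp b s d)
      (fun i => if i ∈ s then c i - d i else 0) := by
    intro i
    rw [sub_apply, isEigenbasis_diagOp b s c i, isEigenbasis_diagOp b s d i, ← sub_smul]
    by_cases hi : i ∈ s <;> simp [hi]
  rw [schattenNorm, h.posTrace_abs_rpow ((diagOp_nonneg b s hc).isSelfAdjoint.sub
    (diagOp_nonneg b s hd).isSelfAdjoint) hp.le]
  simp_rw [apply_ite (fun x : ℝ => |x|), abs_zero]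
  rw [toReal_tsum_ofReal_ite_rpow s (fun i _ => abs_nonneg (c i - d i)) hp]

theorem infinite_basisIndex (hinf : ¬ FiniteDimensional ℂ H) : Infinite (BasisIndex H) := by
  by_contra h
  rw [not_infinite_iff_finite] at h
  have := Fintype.ofFinite (BasisIndex H)
  exact hinf (stdBasis H).toOrthonormalBasis.toBasis.finiteDimensional_of_finite

theorem not_uniformContinuousOnStates_renyiEntropy (hinf : ¬ FiniteDimensional ℂ H) {α p : ℝ}
    (hα : 1 < α) (hp : 1 ≤ p) : ¬ UniformContinuousOnStates p (renyiEntropy (H := H) α) := by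
  classical
  intro hU
  obtain ⟨η, hη, hF⟩ := hU 1 one_pos
  have := infinite_basisIndex hinf
  -- The bound `1 / 2` keeps `1 - ε` positive, and `η / 4` makes the distance bound `2 * ε` smaller
  -- than `η`.
  set ε : ℝ := min (1 / 2) (η / 4) with hε
  have hε0 : 0 < ε := by positivity
  have hε1 : ε ≤ 1 / 2 := min_le_left _ _
  have hεη : 2 * ε < η := by linarith [min_le_right (1 / 2) (η / 4)]
  -- The entropy of the perturbed state is at most `-(α * log ε / (α - 1))` for every `n`; this `n`
  -- puts `log n`, the entropy of the uniform state, at least `1` above it.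
  obtain ⟨n, hn, hn1⟩ : ∃ n : ℕ, 1 - α * Real.log ε / (α - 1) ≤ Real.log n ∧ 1 ≤ n :=
    (((Real.tendsto_log_atTop.comp tendsto_natCast_atTop_atTop).eventually_ge_atTop _).and
      (Filter.eventually_ge_atTop 1)).exists
  have hn0 : (0 : ℝ) < n := by exact_mod_cast hn1
  obtain ⟨s, hs⟩ := Infinite.exists_subset_card_eq (BasisIndex H) n
  obtain ⟨k, hk⟩ := Infinite.exists_notMem_finset s
  have hne : ∀ i ∈ s, i ≠ k := fun i hi h => hk (h ▸ hi)
  let b := stdBasis H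
  let c : BasisIndex H → ℝ := fun i => if i = k then ε else (1 - ε) / n
  let d : BasisIndex H → ℝ := fun i => if i = k then 0 else 1 / n
  have hc : ∀ i, 0 ≤ c i := by
    intro i
    simp only [c]
    split_ifs
    · exact hε0.le
    · exact div_nonneg (by linarith) hn0.le
  have hd : ∀ i, 0 ≤ d i := by
    intro i
    simp only [d]
    split_ifs <;> positivity
  have sum_eq : ∀ (f : ℝ → ℝ → ℝ), ∑ i ∈ insert k s, f (c i) (d i) =
      f ε 0 + n * f ((1 - ε) / n) (1 / n) := by
    intro f
    rw [Finset.sum_insert hk, Finset.sum_congr rfl (g := fun _ => f ((1 - ε) / n) (1 / n))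
      (fun i hi => by simp [c, d, hne i hi]), Finset.sum_const, hs, nsmul_eq_mul]
    simp [c, d]
  have hρ : IsState (diagOp b (insert k s) c) := by
    refine ⟨(ContinuousLinearMap.nonneg_iff_isPositive _).1 (diagOp_nonneg b _ fun i _ => hc i), ?_⟩
    rw [posTrace_diagOp b _ fun i _ => hc i, sum_eq fun x _ => x, mul_div_cancel₀ _ hn0.ne']
    simp
  have hσ : IsState (diagOp b (insert k s) d) := by
    refine ⟨(ContinuousLinearMap.nonneg_iff_isPositive _).1 (diagOp_nonneg b _ fun i _ => hd i), ?_⟩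
    rw [posTrace_diagOp b _ fun i _ => hd i, sum_eq fun _ x => x, mul_div_cancel₀ _ hn0.ne']
    simp
  have hdist : schattenNorm p (diagOp b (insert k s) c - diagOp b (insert k s) d) < η := by
    refine lt_of_le_of_lt ?_ hεη
    rw [schattenNorm_diagOp_sub b _ (fun i _ => hc i) (fun i _ => hd i) (by linarith),
      sum_eq fun x y => |x - y| ^ p]
    have h1 : |(1 - ε) / n - 1 / n| = ε / n := by
      rw [← sub_div, sub_sub_cancel_left, abs_div, abs_neg, abs_of_pos hε0, abs_of_pos hn0]
    have h2 : (n : ℝ) ≤ n ^ p := by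
      simpa using Real.rpow_le_rpow_of_exponent_le (x := n) (by exact_mod_cast hn1) hp
    have h3 : (n : ℝ) * (ε / n) ^ p ≤ ε ^ p := by
      rw [Real.div_rpow hε0.le hn0.le, mul_div_assoc', div_le_iff₀ (by positivity), mul_comm]
      exact mul_le_mul_of_nonneg_left h2 (by positivity)
    have h4 : (2 : ℝ) ≤ 2 ^ p := by
      simpa using Real.rpow_le_rpow_of_exponent_le (x := 2) (by norm_num) hp
    have h5 : ε ^ p + n * (ε / n) ^ p ≤ (2 * ε) ^ p := by
      rw [Real.mul_rpow (by norm_num) hε0.le]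
      nlinarith [Real.rpow_pos_of_pos hε0 p]
    rw [h1, sub_zero, abs_of_pos hε0]
    calc _ ≤ ((2 * ε) ^ p) ^ (1 / p) := by gcongr
      _ = 2 * ε := by
        rw [← Real.rpow_mul (by positivity), mul_one_div_cancel (by linarith), Real.rpow_one]
  have hlt := hF _ _ hρ hσ hdist
  have hα0 : 0 < α - 1 := by linarith
  have hRσ : renyiEntropy α (diagOp b (insert k s) d) = Real.log n := by
    rw [renyiEntropy, toReal_posTrace_diagOp_rpow b _ (fun i _ => hd i) (by linarith),
      sum_eq fun _ x => x ^ α, Real.zero_rpow (by linarith), zero_add,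
      Real.log_mul hn0.ne' (by positivity), Real.log_rpow (by positivity), one_div, Real.log_inv,
      div_eq_iff (by linarith)]
    ring
  -- The single eigenvalue `ε` already forces `tr ρ ^ α ≥ ε ^ α`.
  have hRρ : renyiEntropy α (diagOp b (insert k s) c) ≤ -(α * Real.log ε / (α - 1)) := by
    rw [renyiEntropy, toReal_posTrace_diagOp_rpow b _ (fun i _ => hc i) (by linarith),
      sum_eq fun x _ => x ^ α, ← neg_sub α 1, div_neg, neg_le_neg_iff, ← Real.log_rpow hε0]
    refine div_le_div_of_nonneg_right (Real.log_le_log (by positivity) ?_) hα0.le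
    have : 0 ≤ (n : ℝ) * ((1 - ε) / n) ^ α :=
      mul_nonneg hn0.le (Real.rpow_nonneg (div_nonneg (by linarith) hn0.le) _)
    linarith
  rw [hRσ] at hlt
  have := (abs_lt.1 hlt).1
  linarith

/-! ### Hamiltonians with a bounded inverse -/

theorem IsPosDefHamiltonian.inner_symm {A : H →ₗ.[ℂ] H} (hA : IsPosDefHamiltonian A)
    (x y : A.domain) : inner ℂ (A x) (y : H) = inner ℂ (x : H) (A y) := by
  have h := LinearPMap.adjoint_isFormalAdjoint hA.isSelfAdjoint.dense_domain
  rw [LinearPMap.isSelfAdjoint_def.1 hA.isSelfAdjoint] at h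
  exact h x y

omit [CompleteSpace H] in
theorem IsBoundedInverse.exists_apply_eq {A : H →ₗ.[ℂ] H} {B : H →L[ℂ] H}
    (hB : IsBoundedInverse A B) (y : H) : ∃ h : B y ∈ A.domain, A ⟨B y, h⟩ = y := by
  obtain ⟨x, rfl⟩ := hB.2 y
  have h := hB.1 x
  refine ⟨h ▸ x.2, ?_⟩
  congr 1
  exact Subtype.ext h

omit [CompleteSpace H] in
theorem IsBoundedInverse.unique {A : H →ₗ.[ℂ] H} {B C : H →L[ℂ] H}
    (hB : IsBoundedInverse A B) (hC : IsBoundedInverse A C) : B = C := by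
  ext y
  obtain ⟨x, rfl⟩ := hB.2 y
  rw [hB.1, hC.1]

theorem IsBoundedInverse.traceNegPow_eq {A : H →ₗ.[ℂ] H} {B : H →L[ℂ] H}
    (hB : IsBoundedInverse A B) (s : ℝ) : traceNegPow A s = posTrace (B ^ s) :=
  le_antisymm (iInf₂_le B hB) (le_iInf₂ fun C hC => by rw [hB.unique hC])

omit [CompleteSpace H] in
theorem IsBoundedInverse.eq_zero_of_apply_eq_zero {A : H →ₗ.[ℂ] H} {B : H →L[ℂ] H}
    (hB : IsBoundedInverse A B) {y : H} (hy : B y = 0) : y = 0 := by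
  obtain ⟨x, rfl⟩ := hB.2 y
  rw [hB.1] at hy
  rw [Subtype.ext (a2 := (0 : A.domain)) hy, LinearPMap.map_zero]

theorem IsBoundedInverse.nonneg {A : H →ₗ.[ℂ] H} (hA : IsPosDefHamiltonian A) {B : H →L[ℂ] H}
    (hB : IsBoundedInverse A B) : 0 ≤ B := by
  rw [ContinuousLinearMap.nonneg_iff_isPositive]
  refine isPositive_of_inner_eq (f := fun y => (inner ℂ (B y) y).re) (fun y => ?_) fun y => ?_
  · obtain ⟨x, rfl⟩ := hB.2 y
    rw [hB.1]
    by_cases hx : (x : H) = 0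
    · simp [hx]
    · exact (hA.inner_pos x hx).le
  · obtain ⟨x, rfl⟩ := hB.2 y
    rw [hB.1]
    refine (Complex.conj_eq_iff_re.1 ?_).symm
    rw [inner_conj_symm, hA.inner_symm]

/-- A positive operator some positive power of which has finite trace has an orthonormal basis of
eigenvectors. -/
theorem exists_isEigenbasis_of_posTrace_rpow_ne_top.{u} {H : Type u} [NormedAddCommGroup H]
    [InnerProductSpace ℂ H] [CompleteSpace H] {B : H →L[ℂ] H} (hB : 0 ≤ B) {s : ℝ} (hs : 0 < s)
    (h : posTrace (B ^ s) ≠ ∞) :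
    ∃ (ι : Type u) (b : HilbertBasis ι ℂ H) (c : ι → ℝ), IsEigenbasis b B c := by
  obtain ⟨ι, b, e, he⟩ := exists_isEigenbasis_of_isCompactOperator
    (CFC.rpow_nonneg (a := B) (y := s)).isSelfAdjoint
    (isCompactOperator_of_posTrace_ne_top CFC.rpow_nonneg h)
  -- An eigenbasis of `B ^ s` also diagonalizes `(B ^ s) ^ s⁻¹ = B`.
  refine ⟨ι, b, fun i => e i ^ s⁻¹, ?_⟩
  have h1 := he.rpow CFC.rpow_nonneg (inv_nonneg.2 hs.le)
  rwa [CFC.rpow_rpow_of_exponent_nonneg _ _ _ hs.le (inv_nonneg.2 hs.le), mul_inv_cancel₀ hs.ne',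
    CFC.rpow_one B] at h1

omit [CompleteSpace H] in
theorem IsEigenbasis.ext {ι : Type*} {b : HilbertBasis ι ℂ H} {S T : H →L[ℂ] H} {c : ι → ℝ}
    (hS : IsEigenbasis b S c) (hT : IsEigenbasis b T c) : S = T := by
  refine ContinuousLinearMap.ext_on
    (Submodule.dense_iff_topologicalClosure_eq_top.2 b.dense_span) ?_
  rintro _ ⟨i, rfl⟩
  rw [hS i, hT i]

omit [CompleteSpace H] in
theorem hilbertBasis_ext {ι : Type*} (b : HilbertBasis ι ℂ H) {x y : H}
    (h : ∀ i, inner ℂ (b i) x = inner ℂ (b i) y) : x = y := by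
  apply b.repr.injective
  ext i
  rw [b.repr_apply_apply, b.repr_apply_apply, h]

/-! ### Spectral resolutions act as expected on eigenvectors -/

namespace SpectralResolution

variable {A : H →ₗ.[ℂ] H} (R : SpectralResolution A)

theorem inner_proj_left {S : Set ℝ} (hS : MeasurableSet S) (x y : H) :
    inner ℂ (R.proj S x) y = inner ℂ x (R.proj S y) := by
  conv_rhs => rw [← ContinuousLinearMap.adjoint_inner_left,
    (R.isStarProjection S hS).isSelfAdjoint.adjoint_eq]

theorem proj_proj {S T : Set ℝ} (hS : MeasurableSet S) (hT : MeasurableSet T) (x : H) :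
    R.proj S (R.proj T x) = R.proj (S ∩ T) x := by
  rw [R.proj_inter S T hS hT, mul_apply_eq_comp]

theorem inner_proj_proj {S T U : Set ℝ} (hS : MeasurableSet S) (hT : MeasurableSet T)
    (hU : MeasurableSet U) (x : H) :
    inner ℂ (R.proj S x) (R.proj T (R.proj U x)) = inner ℂ x (R.proj (S ∩ (T ∩ U)) x) := by
  rw [R.inner_proj_left hS, R.proj_proj hT hU, R.proj_proj hS (hT.inter hU)]

theorem re_inner_proj {S : Set ℝ} (hS : MeasurableSet S) (x : H) :
    (inner ℂ x (R.proj S x)).re = ‖R.proj S x‖ ^ 2 := by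
  have h := R.inner_proj_left hS x (R.proj S x)
  rw [R.proj_proj hS hS, Set.inter_self] at h
  rw [← h, inner_self_eq_norm_sq_to_K]
  norm_cast

theorem meas_apply_eq {S : Set ℝ} (hS : MeasurableSet S) (x : H) :
    R.meas x S = ENNReal.ofReal (‖R.proj S x‖ ^ 2) := by
  rw [R.meas_apply x S hS, R.re_inner_proj hS]

theorem isFiniteMeasure_meas (x : H) : IsFiniteMeasure (R.meas x) :=
  ⟨by rw [R.meas_apply_eq MeasurableSet.univ]; exact ENNReal.ofReal_lt_top⟩

theorem proj_empty_apply (x : H) : R.proj ∅ x = 0 := by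
  have h := R.meas_apply_eq MeasurableSet.empty x
  rw [measure_empty, eq_comm, ENNReal.ofReal_eq_zero] at h
  have : ‖R.proj ∅ x‖ = 0 := by nlinarith [norm_nonneg (R.proj ∅ x)]
  exact norm_eq_zero.1 this

theorem meas_proj {S : Set ℝ} (hS : MeasurableSet S) (x : H) :
    R.meas (R.proj S x) = (R.meas x).restrict S := by
  ext T hT
  rw [Measure.restrict_apply hT, R.meas_apply_eq hT, R.meas_apply_eq (hT.inter hS),
    R.proj_proj hT hS]

/-- The vector `x + P x` doubles the component of `x` in the range of `P = proj S`, so mass on `S`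
is multiplied by `4 = 1 + 3`. This serves as a polarization identity. -/
theorem meas_add_proj {S : Set ℝ} (hS : MeasurableSet S) (x : H) :
    R.meas (x + R.proj S x) = R.meas x + (3 : ℝ≥0∞) • (R.meas x).restrict S := by
  ext T hT
  rw [Measure.add_apply, Measure.smul_apply, Measure.restrict_apply hT, R.meas_apply x T hT,
    R.meas_apply x _ (hT.inter hS), R.meas_apply _ T hT, smul_eq_mul]
  have h1 : inner ℂ (x + R.proj S x) (R.proj T (x + R.proj S x)) =
      inner ℂ x (R.proj T x) + 3 * inner ℂ x (R.proj (T ∩ S) x) := by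
    rw [map_add, inner_add_left, inner_add_right, inner_add_right,
      R.inner_proj_proj hS hT hS, R.inner_proj_left hS, R.proj_proj hT hS, R.proj_proj hS hT,
      Set.inter_comm S (T ∩ S), Set.inter_assoc, Set.inter_self, Set.inter_comm S T]
    ring
  have h2 : (3 : ℝ≥0∞) = ENNReal.ofReal 3 := by simp
  rw [h1, h2, ← ENNReal.ofReal_mul (by norm_num), ← ENNReal.ofReal_add]
  · simp
  · rw [R.re_inner_proj hT]; positivity
  · rw [R.re_inner_proj (hT.inter hS)]; positivity

theorem integrable_id_meas {x : H} (hx : x ∈ A.domain) : Integrable (fun t : ℝ => t) (R.meas x) := by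
  have := R.isFiniteMeasure_meas x
  have h2 : Integrable (fun t : ℝ => t ^ 2) (R.meas x) := by
    refine ⟨by fun_prop, ?_⟩
    rw [hasFiniteIntegral_iff_ofReal (.of_forall fun t => sq_nonneg t)]
    exact (R.mem_domain_iff x).1 hx
  refine ((integrable_const (1 : ℝ)).add h2).mono' (by fun_prop) (.of_forall fun t => ?_)
  simp only [Pi.add_apply, Real.norm_eq_abs]
  nlinarith [sq_nonneg (|t| - 1), sq_abs t, abs_nonneg t]

theorem proj_mem_domain {S : Set ℝ} (hS : MeasurableSet S) {x : H} (hx : x ∈ A.domain) :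
    R.proj S x ∈ A.domain := by
  rw [R.mem_domain_iff, R.meas_proj hS]
  exact (lintegral_mono' Measure.restrict_le_self le_rfl).trans_lt ((R.mem_domain_iff x).1 hx)

/-- The spectral projection of a self-adjoint operator onto `{h}` fixes the eigenvectors with
eigenvalue `h`. -/
theorem proj_singleton_apply_eigenvector (hA : IsPosDefHamiltonian A) {x : A.domain} {h : ℝ}
    (hx : A x = (h : ℂ) • (x : H)) : R.proj {h} (x : H) = x := by
  have hfin := R.isFiniteMeasure_meas (x : H)
  have hint := R.integrable_id_meas x.2
  -- A resolution only records the quadratic form of `A`. Evaluating it at `x`, at `u = proj S x`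
  -- and at `x + u` isolates the cross terms, each equal to `h * meas x S` because `x` is an
  -- eigenvector. Over all `S` this forces `t = h` almost everywhere.
  have key : ∀ S, MeasurableSet S →
      ∫ t in S, t ∂(R.meas (x : H)) = h * (R.meas (x : H)).real S := by
    intro S hS
    let u : A.domain := ⟨R.proj S x, R.proj_mem_domain hS x.2⟩
    have e1 := R.inner_apply x
    have e2 := R.inner_apply u
    have e3 := R.inner_apply (x + u)
    have e4 : ((x + u : A.domain) : H) = x + R.proj S x := rfl
    rw [e4, R.meas_add_proj hS, integral_add_measure hint
      ((hint.mono_measure Measure.restrict_le_self).smul_measure (by simp)),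
      integral_smul_measure, LinearPMap.map_add, inner_add_left, inner_add_right, inner_add_right,
      e1] at e3
    change inner ℂ (R.proj S x) (A u) = _ at e2
    rw [show (u : H) = R.proj S x from rfl, R.meas_proj hS] at e2
    have e5 : inner ℂ (R.proj S x) (A x) = ((h * (R.meas (x : H)).real S : ℝ) : ℂ) := by
      rw [hx, inner_smul_right, R.inner_proj_left hS, measureReal_def, R.meas_apply _ S hS,
        R.re_inner_proj hS, ENNReal.toReal_ofReal (by positivity)]
      have h6 := R.inner_proj_left hS x (R.proj S x)
      rw [R.proj_proj hS hS, Set.inter_self] at h6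
      rw [← h6, inner_self_eq_norm_sq_to_K]
      push_cast
      rfl
    have e6 : inner ℂ (x : H) (A u) = ((h * (R.meas (x : H)).real S : ℝ) : ℂ) := by
      rw [← hA.inner_symm, ← inner_conj_symm, show (u : H) = R.proj S x from rfl, e5,
        Complex.conj_ofReal]
    rw [e2, e5, e6] at e3
    have e7 := congrArg Complex.re e3
    simp only [Complex.add_re, Complex.ofReal_re, ENNReal.toReal_ofNat, smul_eq_mul] at e7
    linarith
  have hzero : (fun t : ℝ => t - h) =ᵐ[R.meas (x : H)] 0 := by
    refine (hint.sub (integrable_const h)).ae_eq_zero_of_forall_setIntegral_eq_zero ?_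
    intro S hS _
    simp only [Pi.sub_apply]
    rw [integral_sub hint.integrableOn (integrable_const h), key S hS]
    simp [mul_comm]
  have hae : ∀ᵐ t ∂(R.meas (x : H)), t ∈ ({h} : Set ℝ) := by
    filter_upwards [hzero] with t ht
    simpa [sub_eq_zero] using ht
  have hm : R.meas (x : H) {h} = R.meas (x : H) Set.univ :=
    (measure_eq_measure_of_null_sdiff (Set.subset_univ _) (by
      rw [← Set.compl_eq_univ_sdiff]; exact hae))
  rw [R.meas_apply_eq (measurableSet_singleton h), R.meas_apply_eq MeasurableSet.univ, R.proj_univ,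
    ENNReal.ofReal_eq_ofReal_iff (by positivity) (by positivity)] at hm
  -- The measure lives on `{h}`, so projecting preserves the norm of `x`; an orthogonal projection
  -- then fixes `x`.
  have hre := R.re_inner_proj (measurableSet_singleton h) (x : H)
  have hn := @norm_sub_sq ℂ H _ _ _ (x : H) (R.proj {h} x)
  simp only [one_apply_eq_self, RCLike.re_to_complex] at hm hn
  rw [hre, hm] at hn
  have : ‖(x : H) - R.proj {h} x‖ = 0 := by
    nlinarith [norm_nonneg ((x : H) - R.proj {h} x)]
  exact (sub_eq_zero.1 (norm_eq_zero.1 this)).symm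

open Classical in
theorem proj_apply_eigenvector (hA : IsPosDefHamiltonian A) {x : A.domain} {h : ℝ}
    (hx : A x = (h : ℂ) • (x : H)) {S : Set ℝ} (hS : MeasurableSet S) :
    R.proj S (x : H) = ((if h ∈ S then 1 else 0 : ℝ) : ℂ) • (x : H) := by
  have h1 := R.proj_singleton_apply_eigenvector hA hx
  have h2 : R.proj S (x : H) = R.proj (S ∩ {h}) x := by
    rw [← R.proj_proj hS (measurableSet_singleton h), h1]
  rw [h2]
  split_ifs with hh
  · rw [Set.inter_eq_right.2 (Set.singleton_subset_iff.2 hh), h1]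
    simp
  · rw [Set.inter_singleton_eq_empty.2 hh, R.proj_empty_apply]
    simp

end SpectralResolution

/-! ### The spectral resolution of a diagonal Hamiltonian and the energy -/

open Classical in
/-- The orthogonal projection which keeps exactly the vectors `b i` with `i ∈ s` of the orthonormal
basis `b`. -/
theorem exists_isStarProjection_isEigenbasis {ι : Type*} (b : HilbertBasis ι ℂ H) (s : Set ι) :
    ∃ P : H →L[ℂ] H, IsStarProjection P ∧ IsEigenbasis b P (fun i => if i ∈ s then 1 else 0) := by
  let K := (Submodule.span ℂ (b '' s)).topologicalClosure
  have : CompleteSpace K := (Submodule.isClosed_topologicalClosure _).completeSpace_coe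
  refine ⟨K.starProjection, isStarProjection_starProjection, fun i => ?_⟩
  beta_reduce
  split_ifs with hi
  · rw [Submodule.starProjection_eq_self_iff.2]
    · simp
    · exact Submodule.le_topologicalClosure _ (Submodule.subset_span ⟨i, hi, rfl⟩)
  · rw [(Submodule.starProjection_apply_eq_zero_iff K).2]
    · simp
    · rw [Submodule.orthogonal_closure, Submodule.mem_orthogonal]
      intro u hu
      induction hu using Submodule.span_induction with
      | mem u hu =>
        obtain ⟨j, hj, rfl⟩ := hu
        exact b.orthonormal.2 fun h => hi (h ▸ hj)
      | zero => simp
      | add u v _ _ hu hv => rw [inner_add_left, hu, hv, add_zero]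
      | smul a u _ hu => rw [inner_smul_left, hu, mul_zero]

omit [CompleteSpace H] in
theorem IsBoundedInverse.exists_apply_eigenvector {A : H →ₗ.[ℂ] H} {B : H →L[ℂ] H}
    (hB : IsBoundedInverse A B) {x : H} {c : ℝ} (hx : B x = (c : ℂ) • x) (hc : c ≠ 0) :
    ∃ h : x ∈ A.domain, A ⟨x, h⟩ = ((c⁻¹ : ℝ) : ℂ) • x := by
  have h1 : B (((c⁻¹ : ℝ) : ℂ) • x) = x := by
    rw [map_smul, hx, smul_smul, ← Complex.ofReal_mul, inv_mul_cancel₀ hc]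
    simp
  have h2 := hB.exists_apply_eq (((c⁻¹ : ℝ) : ℂ) • x)
  rwa [h1] at h2

theorem inner_apply_eq_of_eigenvector {A : H →ₗ.[ℂ] H} (hA : IsPosDefHamiltonian A)
    {e : A.domain} {h : ℝ} (he : A e = (h : ℂ) • (e : H)) (x : A.domain) :
    inner ℂ (e : H) (A x) = h * inner ℂ (e : H) (x : H) := by
  rw [← hA.inner_symm, he, inner_smul_left, Complex.conj_ofReal]

/-- A Hamiltonian with an orthonormal basis of eigenvectors (and a bounded inverse) has a spectral
resolution. -/
theorem nonempty_spectralResolution {A : H →ₗ.[ℂ] H} (hA : IsPosDefHamiltonian A)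
    {B : H →L[ℂ] H} (hB : IsBoundedInverse A B) {ι : Type*} {b : HilbertBasis ι ℂ H}
    {c : ι → ℝ} (hc : IsEigenbasis b B c) (hpos : ∀ i, 0 < c i) :
    Nonempty (SpectralResolution A) := by
  classical
  choose hm he using fun i => hB.exists_apply_eigenvector (hc i) (hpos i).ne'
  choose P hP hPb using fun S : Set ℝ =>
    exists_isStarProjection_isEigenbasis b {i | (c i)⁻¹ ∈ S}
  have hinner : ∀ S i x, inner ℂ (b i) (P S x) =
      ((if (c i)⁻¹ ∈ S then 1 else 0 : ℝ) : ℂ) * inner ℂ (b i) x := fun S i x => by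
    rw [(hPb S).inner_eq (hP S).isSelfAdjoint]
    rfl
  let μ : H → Measure ℝ := fun x =>
    Measure.sum fun i => ENNReal.ofReal (‖inner ℂ (b i) x‖ ^ 2) • Measure.dirac (c i)⁻¹
  have hlint : ∀ x (f : ℝ → ℝ≥0∞), Measurable f → ∫⁻ t, f t ∂(μ x) =
      ∑' i, ENNReal.ofReal (‖inner ℂ (b i) x‖ ^ 2) * f (c i)⁻¹ := fun x f hf => by
    simp only [μ, lintegral_sum_measure, lintegral_smul_measure, lintegral_dirac' _ hf, smul_eq_mul]
  have hcoord : ∀ x : A.domain, ∀ i, inner ℂ (b i) (A x) =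
      (((c i)⁻¹ : ℝ) : ℂ) * inner ℂ (b i) (x : H) := fun x i =>
    inner_apply_eq_of_eigenvector hA (he i) x
  refine ⟨⟨P, μ, fun S _ => hP S, ?_, fun S T _ _ => ?_, fun x S hS => ?_, fun x => ?_,
    fun x => ?_⟩⟩
  · refine (hPb Set.univ).ext fun i => ?_
    simp
  · refine (hPb (S ∩ T)).ext fun i => ?_
    rw [mul_apply_eq_comp, hPb T i, map_smul, hPb S i, smul_smul]
    simp only [Set.mem_ofPred_eq, Set.mem_inter_iff]
    split_ifs <;> simp_all
  · have h1 := hlint x (S.indicator 1) (measurable_one.indicator hS)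
    rw [lintegral_indicator_one hS] at h1
    have h2 := (hPb S).hasSum_inner (hP S).isSelfAdjoint x
    rw [h1, ← h2.tsum_eq, ENNReal.ofReal_tsum_of_nonneg _ h2.summable]
    · refine tsum_congr fun i => ?_
      by_cases hi : (c i)⁻¹ ∈ S <;> simp [hi]
    · intro i
      split_ifs <;> simp
  · rw [hlint x _ (by fun_prop)]
    have hterm : ∀ i, ENNReal.ofReal (‖inner ℂ (b i) x‖ ^ 2) * ENNReal.ofReal ((c i)⁻¹ ^ 2) =
        ENNReal.ofReal (‖(((c i)⁻¹ : ℝ) : ℂ) * inner ℂ (b i) x‖ ^ 2) := fun i => by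
      rw [← ENNReal.ofReal_mul (by positivity), norm_mul, mul_pow, Complex.norm_real,
        Real.norm_eq_abs, sq_abs, mul_comm]
    simp_rw [hterm]
    constructor
    · intro hx
      simp_rw [← hcoord ⟨x, hx⟩]
      rw [tsum_ofReal_norm_inner_sq b]
      exact ENNReal.ofReal_lt_top
    -- The second moment bound says that the would-be coordinates of `A x` are square summable. They
    -- define a vector `y` with `B y = x`, which places `x` in the domain.
    · intro hlt
      have hsum : Summable fun i => ‖(((c i)⁻¹ : ℝ) : ℂ) * inner ℂ (b i) x‖ ^ 2 := by
        have := ENNReal.summable_toReal hlt.ne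
        exact this.congr fun i => ENNReal.toReal_ofReal (sq_nonneg _)
      have hmem : Memℓp (fun i => (((c i)⁻¹ : ℝ) : ℂ) * inner ℂ (b i) x) 2 := by
        refine memℓp_gen ?_
        simpa using hsum
      let y : H := b.repr.symm ⟨_, hmem⟩
      have hy : ∀ i, inner ℂ (b i) y = (((c i)⁻¹ : ℝ) : ℂ) * inner ℂ (b i) x := fun i => by
        rw [← b.repr_apply_apply, LinearIsometryEquiv.apply_symm_apply]
      have hxy : B y = x := hilbertBasis_ext b fun i => by
        rw [hc.inner_eq (hB.nonneg hA).isSelfAdjoint, hy, ← mul_assoc, ← Complex.ofReal_mul,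
          mul_inv_cancel₀ (hpos i).ne']
        simp
      obtain ⟨h, _⟩ := hB.exists_apply_eq y
      rwa [hxy] at h
  · have hnn : 0 ≤ᵐ[μ x] fun t : ℝ => t := by
      have : ∀ᵐ t ∂(μ x), 0 ≤ t := by
        rw [Measure.ae_sum_iff' measurableSet_Ici]
        intro i
        refine Measure.ae_smul_measure ?_ _
        rw [ae_dirac_iff measurableSet_Ici]
        exact (inv_pos.2 (hpos i)).le
      exact this
    have h1 := b.hasSum_inner_mul_inner (x : H) (A x)
    have h2 : HasSum (fun i => (((c i)⁻¹ * ‖inner ℂ (b i) (x : H)‖ ^ 2 : ℝ) : ℂ))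
        (inner ℂ (x : H) (A x)) := by
      refine h1.congr_fun fun i => ?_
      rw [hcoord, ← inner_conj_symm (x : H), mul_left_comm, Complex.conj_mul']
      push_cast
      rfl
    have h3 := Complex.hasSum_re h2
    simp only [Complex.ofReal_re] at h3
    rw [integral_eq_lintegral_of_nonneg_ae hnn (by fun_prop), hlint _ _ (by fun_prop)]
    have h4 : ∀ i, ENNReal.ofReal (‖inner ℂ (b i) (x : H)‖ ^ 2) * ENNReal.ofReal (c i)⁻¹ =
        ENNReal.ofReal ((c i)⁻¹ * ‖inner ℂ (b i) (x : H)‖ ^ 2) := fun i => by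
      rw [mul_comm, ENNReal.ofReal_mul (inv_pos.2 (hpos i)).le]
    have h5 : ∀ i, 0 ≤ (c i)⁻¹ * ‖inner ℂ (b i) (x : H)‖ ^ 2 := fun i =>
      mul_nonneg (inv_pos.2 (hpos i)).le (sq_nonneg _)
    simp_rw [h4]
    rw [← ENNReal.ofReal_tsum_of_nonneg h5 h3.summable, ENNReal.toReal_ofReal (tsum_nonneg h5),
      ← h2.tsum_eq, Complex.ofReal_tsum]

/-- `A 1_{[0,n]}(A)` is the finite-rank operator given by the eigenvalues in `[0, n]`. -/
theorem applyOrZero_spectralProjection {A : H →ₗ.[ℂ] H} (hA : IsPosDefHamiltonian A)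
    {B : H →L[ℂ] H} (hB : IsBoundedInverse A B) {ι : Type*} {b : HilbertBasis ι ℂ H}
    {c : ι → ℝ} (hc : IsEigenbasis b B c) (hpos : ∀ i, 0 < c i) (n : ℕ) (F : Finset ι)
    (hF : ∀ i, i ∈ F ↔ (c i)⁻¹ ≤ n) (x : H) :
    applyOrZero A (spectralProjection A (Set.Icc 0 n) x) = diagOp b F (fun i => (c i)⁻¹) x := by
  classical
  have hne := nonempty_spectralResolution hA hB hc hpos
  -- The chosen resolution is irrelevant, since every one acts the same way on eigenvectors. The
  -- factor `B` on the left exhibits the range inside the domain of `A`, and `A` then cancels it.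
  have hP : spectralProjection A (Set.Icc 0 n) = B * diagOp b F (fun i => (c i)⁻¹) := by
    refine IsEigenbasis.ext (b := b) (c := fun i => if i ∈ F then 1 else 0) (fun i => ?_)
      fun i => ?_
    · obtain ⟨hm, he⟩ := hB.exists_apply_eigenvector (hc i) (hpos i).ne'
      rw [spectralProjection, dif_pos hne]
      have := hne.some.proj_apply_eigenvector hA he (measurableSet_Icc (a := (0 : ℝ)) (b := n))
      have hiff : (c i)⁻¹ ∈ Set.Icc (0 : ℝ) n ↔ i ∈ F := by
        rw [hF, Set.mem_Icc]
        exact and_iff_right (inv_pos.2 (hpos i)).le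
      simpa only [hiff] using this
    · rw [mul_apply_eq_comp, isEigenbasis_diagOp, map_smul, hc i, smul_smul, ← Complex.ofReal_mul]
      congr 2
      beta_reduce
      split_ifs
      · exact inv_mul_cancel₀ (hpos i).ne'
      · simp
  obtain ⟨hm, he⟩ := hB.exists_apply_eq (diagOp b F (fun i => (c i)⁻¹) x)
  rw [applyOrZero, hP, mul_apply_eq_comp, dif_pos hm, he]

theorem tsum_inner_diagOp {ι : Type*} (b : HilbertBasis ι ℂ H) (F : Finset ι) (h : ι → ℝ)
    {ρ : H →L[ℂ] H} (hρ : IsSelfAdjoint ρ) {κ : Type*} (f : HilbertBasis κ ℂ H) :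
    (∑' k, inner ℂ (f k) (diagOp b F h (ρ (f k)))).re =
      ∑ i ∈ F, h i * (inner ℂ (b i) (ρ (b i))).re := by
  have h1 : ∀ i, HasSum (fun k => (h i : ℂ) * (inner ℂ (ρ (b i)) (f k) * inner ℂ (f k) (b i)))
      ((h i : ℂ) * inner ℂ (ρ (b i)) (b i)) :=
    fun i => (f.hasSum_inner_mul_inner (ρ (b i)) (b i)).mul_left _
  have hs : ∀ x y, inner ℂ (ρ x) y = inner ℂ x (ρ y) := isSymmetric_of_isSelfAdjoint hρ
  have h2 : ∀ k, inner ℂ (f k) (diagOp b F h (ρ (f k))) =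
      ∑ i ∈ F, (h i : ℂ) * (inner ℂ (ρ (b i)) (f k) * inner ℂ (f k) (b i)) := fun k => by
    rw [diagOp_apply, inner_sum]
    refine Finset.sum_congr rfl fun i _ => ?_
    rw [inner_smul_right, inner_smul_right, hs]
  simp_rw [h2]
  rw [(hasSum_sum fun i _ => h1 i).tsum_eq, Complex.re_sum]
  refine Finset.sum_congr rfl fun i _ => ?_
  rw [Complex.re_ofReal_mul, hs]

/-- The energy of a state dominates `∑ i, h i * ⟨b i, ρ (b i)⟩` when `b` is an orthonormal basis of
eigenvectors of the Hamiltonian, with eigenvalues `h i = (c i)⁻¹` tending to infinity. -/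
theorem tsum_le_energy {A : H →ₗ.[ℂ] H} (hA : IsPosDefHamiltonian A)
    {B : H →L[ℂ] H} (hB : IsBoundedInverse A B) {ι : Type*} {b : HilbertBasis ι ℂ H}
    {c : ι → ℝ} (hc : IsEigenbasis b B c) (hpos : ∀ i, 0 < c i)
    (hfin : ∀ n : ℕ, {i | (c i)⁻¹ ≤ n}.Finite) {ρ : H →L[ℂ] H} (hρ : IsState ρ) :
    ∑' i, (ENNReal.ofReal (c i))⁻¹ * ENNReal.ofReal (inner ℂ (b i) (ρ (b i))).re ≤ energy A ρ := by
  rw [ENNReal.tsum_eq_iSup_sum]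
  refine iSup_le fun G => ?_
  -- A finite partial sum involves bounded eigenvalues only, so it is dominated by the truncated
  -- energy at a large enough level.
  obtain ⟨n, hn⟩ : ∃ n : ℕ, ∀ i ∈ G, (c i)⁻¹ ≤ n := by
    obtain ⟨n, hn⟩ := exists_nat_ge (∑ i ∈ G, (c i)⁻¹)
    exact ⟨n, fun i hi => (Finset.single_le_sum (f := fun i => (c i)⁻¹)
      (fun j _ => (inv_pos.2 (hpos j)).le) hi).trans hn⟩
  have hmem : ∀ i, i ∈ (hfin n).toFinset ↔ (c i)⁻¹ ≤ n := fun i => by simp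
  have hnn : ∀ i, 0 ≤ (c i)⁻¹ * (inner ℂ (b i) (ρ (b i))).re := fun i =>
    mul_nonneg (inv_pos.2 (hpos i)).le (hρ.inner_nonneg _)
  have ht : truncatedEnergy A n ρ =
      ∑ i ∈ (hfin n).toFinset, (c i)⁻¹ * (inner ℂ (b i) (ρ (b i))).re := by
    rw [truncatedEnergy, ← tsum_inner_diagOp b _ _ hρ.nonneg.isSelfAdjoint (stdBasis H)]
    simp_rw [applyOrZero_spectralProjection hA hB hc hpos n _ hmem]
  refine le_trans ?_ (le_iSup (fun n => ENNReal.ofReal (truncatedEnergy A n ρ)) n)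
  rw [ht]
  have h1 : ∀ i, (ENNReal.ofReal (c i))⁻¹ * ENNReal.ofReal (inner ℂ (b i) (ρ (b i))).re =
      ENNReal.ofReal ((c i)⁻¹ * (inner ℂ (b i) (ρ (b i))).re) := fun i => by
    rw [ENNReal.ofReal_mul (inv_pos.2 (hpos i)).le, ENNReal.ofReal_inv_of_pos (hpos i)]
  simp_rw [h1]
  rw [← ENNReal.ofReal_sum_of_nonneg fun i _ => hnn i]
  exact ENNReal.ofReal_le_ofReal (Finset.sum_le_sum_of_subset_of_nonneg
    (fun i hi => (hmem i).2 (hn i hi)) fun i _ _ => hnn i)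

/-! ### The lower bound on `tr ρ ^ α` from the energy constraint -/

/-- Hölder's inequality with the weights `c⁻¹`. -/
theorem one_le_mul_tsum_rpow {ι : Type*} {α β : ℝ} (hα : 1 < α) (hβ0 : 0 < β) (hβ1 : β < 1)
    (c P : ι → ℝ≥0∞) (hc0 : ∀ i, c i ≠ 0) (hc : ∀ i, c i ≠ ∞) (hP : ∑' i, P i = 1) :
    1 ≤ (∑' i, (c i)⁻¹ * P i) ^ (α * β / (1 - β)) * (∑' i, P i ^ α) *
      (∑' i, c i ^ (α * β / ((1 - β) * (α - 1)))) ^ (α - 1) := by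
  have hβ : 0 < 1 - β := by linarith
  have hα0 : 0 < α := by linarith
  have hα1 : 0 < α - 1 := by linarith
  have hq1 : Real.HolderConjugate (1 / β) (1 / (1 - β)) := by
    rw [Real.holderConjugate_iff]
    refine ⟨?_, by field_simp; ring⟩
    rw [lt_div_iff₀ hβ0]; linarith
  have hq2 : Real.HolderConjugate α (α / (α - 1)) := by
    rw [Real.holderConjugate_iff]
    exact ⟨hα, by field_simp; ring⟩
  have hPt : ∀ i, P i ≠ ∞ := fun i => ne_top_of_le_ne_top (by simp [hP]) (ENNReal.le_tsum i)
  -- Interpolation: `P` is split so that the powers of `c` cancel, leaving the energy and `∑ P * c ^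
  -- (β / (1 - β))`. The second Hölder separates the latter into `∑ P ^ α` and `τ`.
  have h1 := tsum_mul_le_Lp_mul_Lq hq1 (fun i => ((c i)⁻¹ * P i) ^ β)
    (fun i => (c i ^ (β / (1 - β)) * P i) ^ (1 - β))
  have h2 := tsum_mul_le_Lp_mul_Lq hq2 P (fun i => c i ^ (β / (1 - β)))
  have e1 : ∀ i, ((c i)⁻¹ * P i) ^ β * (c i ^ (β / (1 - β)) * P i) ^ (1 - β) = P i := by
    intro i
    rw [ENNReal.mul_rpow_of_nonneg _ _ hβ0.le, ENNReal.mul_rpow_of_nonneg _ _ hβ.le,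
      ← ENNReal.rpow_mul, div_mul_cancel₀ _ hβ.ne', mul_mul_mul_comm, ENNReal.inv_rpow,
      ENNReal.inv_mul_cancel, one_mul, ← ENNReal.rpow_add_of_nonneg _ _ hβ0.le hβ.le,
      add_sub_cancel, ENNReal.rpow_one]
    · simp [ENNReal.rpow_eq_zero_iff, hc0, hc]
    · exact ENNReal.rpow_ne_top_of_nonneg hβ0.le (hc i)
  have e2 : ∀ i, (((c i)⁻¹ * P i) ^ β) ^ (1 / β) = (c i)⁻¹ * P i := fun i => by
    rw [← ENNReal.rpow_mul, mul_one_div_cancel hβ0.ne', ENNReal.rpow_one]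
  have e3 : ∀ i, ((c i ^ (β / (1 - β)) * P i) ^ (1 - β)) ^ (1 / (1 - β)) =
      P i * c i ^ (β / (1 - β)) := fun i => by
    rw [← ENNReal.rpow_mul, mul_one_div_cancel hβ.ne', ENNReal.rpow_one, mul_comm]
  have e4 : ∀ i, (c i ^ (β / (1 - β))) ^ (α / (α - 1)) =
      c i ^ (α * β / ((1 - β) * (α - 1))) := fun i => by
    rw [← ENNReal.rpow_mul]
    congr 1
    field_simp
  simp_rw [e1, e2, e3, hP, one_div_one_div] at h1
  simp_rw [e4] at h2
  set X := ∑' i, (c i)⁻¹ * P i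
  set Q := ∑' i, P i ^ α
  set τ := ∑' i, c i ^ (α * β / ((1 - β) * (α - 1)))
  have h3 : 1 ≤ X ^ β * (Q ^ (1 / α) * τ ^ (1 / (α / (α - 1)))) ^ (1 - β) :=
    h1.trans (by gcongr)
  -- This power is the one that makes the exponent of `Q` equal to `1`.
  have h4 := ENNReal.rpow_le_rpow h3 (z := α / (1 - β)) (by positivity)
  rw [ENNReal.one_rpow, ENNReal.mul_rpow_of_nonneg _ _ (by positivity), ← ENNReal.rpow_mul,
    ← ENNReal.rpow_mul, mul_div_cancel₀ _ hβ.ne', ENNReal.mul_rpow_of_nonneg _ _ hα0.le,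
    ← ENNReal.rpow_mul, ← ENNReal.rpow_mul, one_div_mul_cancel hα0.ne', ENNReal.rpow_one,
    ← mul_assoc] at h4
  convert h4 using 3 <;> field_simp

/-- A state of bounded energy has `tr ρ ^ α` bounded from below. -/
theorem IsState.le_posTrace_rpow_of_energy_le {ρ : H →L[ℂ] H} (hρ : IsState ρ)
    {A : H →ₗ.[ℂ] H} (hA : IsPosDefHamiltonian A) {E : ℝ}
    (hE : energy A ρ ≤ ENNReal.ofReal E) {α β : ℝ} (hα : 1 < α) (hβ0 : 0 < β) (hβ1 : β < 1)
    (hτ : traceNegPow A (α * β / ((1 - β) * (α - 1))) < ∞) {δ : ℝ}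
    (hδ : δ = E ^ (α * β / (1 - β)) *
      (traceNegPow A (α * β / ((1 - β) * (α - 1)))).toReal ^ (α - 1)) :
    0 < δ ∧ δ⁻¹ ≤ (posTrace (ρ ^ α)).toReal := by
  have hβ : 0 < 1 - β := by linarith
  have hα0 : 0 < α := by linarith
  have hα1 : 0 < α - 1 := by linarith
  set s := α * β / ((1 - β) * (α - 1)) with hs
  have hs0 : 0 < s := by positivity
  have hr : 0 < α * β / (1 - β) := by positivity
  obtain ⟨B, hB, hBs⟩ : ∃ B, IsBoundedInverse A B ∧ posTrace (B ^ s) < ∞ := by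
    simpa [traceNegPow, iInf_lt_iff] using hτ
  have hB0 := hB.nonneg hA
  obtain ⟨ι, b, c, hc⟩ := exists_isEigenbasis_of_posTrace_rpow_ne_top hB0 hs0 hBs.ne
  -- An inverse is injective, so `0` is not an eigenvalue.
  have hpos : ∀ i, 0 < c i := fun i => (hc.nonneg hB0 i).lt_of_ne' fun h0 => by
    have h1 := hc i
    rw [h0, Complex.ofReal_zero, zero_smul] at h1
    exact b.orthonormal.ne_zero i (hB.eq_zero_of_apply_eq_zero h1)
  rw [hB.traceNegPow_eq] at hδ
  rw [hc.posTrace_rpow hB0 hs0.le] at hδ hBs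
  -- Summability of `c i ^ s` leaves only finitely many `c i ≥ 1 / n`. The case `n = 0` is separate
  -- because the threshold `0⁻¹ = 0` would be useless.
  have hfin : ∀ n : ℕ, {i | (c i)⁻¹ ≤ n}.Finite := fun n => by
    rcases n.eq_zero_or_pos with rfl | hn
    · convert Set.finite_empty
      ext i
      simpa using hpos i
    have hn' : (0 : ℝ) < n := by exact_mod_cast hn
    refine (ENNReal.finite_const_le_of_tsum_ne_top hBs.ne
      (ε := ENNReal.ofReal ((n : ℝ)⁻¹) ^ s) ?_).subset fun i hi => ?_
    · simp [ENNReal.rpow_eq_zero_iff, hn, hs0.le]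
    · exact ENNReal.rpow_le_rpow (ENNReal.ofReal_le_ofReal (inv_le_of_inv_le₀ (hpos i) hi)) hs0.le
  have h1 := one_le_mul_tsum_rpow hα hβ0 hβ1 (fun i => ENNReal.ofReal (c i))
    (fun i => ENNReal.ofReal (inner ℂ (b i) (ρ (b i))).re) (fun i => by simpa using hpos i)
    (fun i => ENNReal.ofReal_ne_top) (hρ.tsum_inner b)
  have h2 := (tsum_le_energy hA hB hc hpos hfin hρ).trans hE
  have h3 := hρ.tsum_inner_rpow_le b hα.le
  have h4 : 1 ≤ ENNReal.ofReal E ^ (α * β / (1 - β)) * posTrace (ρ ^ α) *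
      (∑' i, ENNReal.ofReal (c i) ^ s) ^ (α - 1) := h1.trans (by gcongr)
  -- For `E ≤ 0` the truncation `ENNReal.ofReal E` vanishes and the bound would read `1 ≤ 0`.
  have hE0 : 0 < E := by
    by_contra hE'
    rw [ENNReal.ofReal_of_nonpos (not_lt.1 hE'), ENNReal.zero_rpow_of_pos hr] at h4
    simp at h4
  have hfinal : ENNReal.ofReal E ^ (α * β / (1 - β)) * posTrace (ρ ^ α) *
      (∑' i, ENNReal.ofReal (c i) ^ s) ^ (α - 1) ≠ ∞ :=
    ENNReal.mul_ne_top (ENNReal.mul_ne_top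
      (ENNReal.rpow_ne_top_of_nonneg hr.le ENNReal.ofReal_ne_top)
      (ne_top_of_le_ne_top (by simp) (hρ.posTrace_rpow_le_one hα.le)))
      (ENNReal.rpow_ne_top_of_nonneg hα1.le hBs.ne)
  have h5 := ENNReal.toReal_mono hfinal h4
  rw [ENNReal.toReal_mul, ENNReal.toReal_mul, ← ENNReal.toReal_rpow, ← ENNReal.toReal_rpow,
    ENNReal.toReal_ofReal hE0.le, ENNReal.toReal_one, mul_right_comm, ← hδ] at h5
  have hδ0 : 0 ≤ δ := by rw [hδ]; positivity
  have hδpos : 0 < δ := hδ0.lt_of_ne' fun h => by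
    rw [h] at h5
    linarith
  exact ⟨hδpos, by rwa [inv_le_iff_one_le_mul₀' hδpos]⟩

end QuantumEntropy

end

theorem proposition3p9 {H : Type*} [NormedAddCommGroup H] [InnerProductSpace ℂ H]
    [CompleteSpace H] [TopologicalSpace.SeparableSpace H] (hinf : ¬ FiniteDimensional ℂ H)
    (α : ℝ) (hα : 1 < α) :
    -- the quantities below are well defined
    (∀ ρ : H →L[ℂ] H, IsState ρ → 0 < posTrace (ρ ^ α) ∧ posTrace (ρ ^ α) < ⊤) ∧
    (∀ ρ σ : H →L[ℂ] H, IsState ρ → IsState σ → MemSchatten α (ρ - σ)) ∧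
    -- Lipschitz continuity of the Tsallis entropy
    (∀ ρ σ : H →L[ℂ] H, IsState ρ → IsState σ →
      |tsallisEntropy α ρ - tsallisEntropy α σ|
          ≤ |schattenNorm α ρ ^ α - schattenNorm α σ ^ α| / (α - 1) ∧
        |schattenNorm α ρ ^ α - schattenNorm α σ ^ α| / (α - 1)
          ≤ α / (α - 1) * schattenNorm α (ρ - σ)) ∧
    -- the Rényi entropy is not uniformly continuous on the set of all states,
    -- neither in the Schatten `α`-distance nor in the trace distance
    ¬ UniformContinuousOnStates α (renyiEntropy (H := H) α) ∧
    ¬ UniformContinuousOnStates 1 (renyiEntropy (H := H) α) ∧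
    -- the bound for the Rényi entropy under the first condition
    (∀ ρ σ : H →L[ℂ] H, IsState ρ → IsState σ → ∀ δ : ℝ, 0 < δ →
      δ⁻¹ ≤ (posTrace (ρ ^ α)).toReal → δ⁻¹ ≤ (posTrace (σ ^ α)).toReal →
      |renyiEntropy α ρ - renyiEntropy α σ| ≤ α * δ / (α - 1) * schattenNorm α (ρ - σ)) ∧
    -- the bound for the Rényi entropy under the energy constraint
    (∀ ρ σ : H →L[ℂ] H, IsState ρ → IsState σ →
      ∀ A : H →ₗ.[ℂ] H, IsPosDefHamiltonian A →
      ∀ E : ℝ, energy A ρ ≤ ENNReal.ofReal E → energy A σ ≤ ENNReal.ofReal E →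
      ∀ β : ℝ, 0 < β → β < 1 →
      traceNegPow A (α * β / ((1 - β) * (α - 1))) < ⊤ →
      ∀ τ : ℝ, τ = (traceNegPow A (α * β / ((1 - β) * (α - 1)))).toReal →
      ∀ δ : ℝ, δ = E ^ (α * β / (1 - β)) * τ ^ (α - 1) →
        0 < δ ∧
        |renyiEntropy α ρ - renyiEntropy α σ| ≤ α * δ / (α - 1) * schattenNorm α (ρ - σ)) := by
  refine ⟨fun ρ hρ => ⟨hρ.posTrace_rpow_pos hα.le,
      (hρ.posTrace_rpow_le_one hα.le).trans_lt (by simp)⟩,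
    fun ρ σ hρ hσ => hρ.memSchatten_sub hσ hα.le,
    fun ρ σ hρ hσ => ⟨(hρ.abs_tsallisEntropy_sub_eq hσ hα).le, ?_⟩,
    not_uniformContinuousOnStates_renyiEntropy hinf hα hα.le,
    not_uniformContinuousOnStates_renyiEntropy hinf hα le_rfl,
    fun ρ σ hρ hσ δ hδ h1 h2 => hρ.abs_renyiEntropy_sub_le hσ hα hδ h1 h2, ?_⟩
  · rw [div_mul_eq_mul_div]
    exact div_le_div_of_nonneg_right (hρ.abs_schattenNorm_rpow_sub_le hσ hα.le) (by linarith)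
  · intro ρ σ hρ hσ A hA E hEρ hEσ β hβ0 hβ1 hτ τ hτ_eq δ hδ
    subst hτ_eq
    obtain ⟨hδ0, h1⟩ := hρ.le_posTrace_rpow_of_energy_le hA hEρ hα hβ0 hβ1 hτ hδ
    obtain ⟨-, h2⟩ := hσ.le_posTrace_rpow_of_energy_le hA hEσ hα hβ0 hβ1 hτ hδ
    exact ⟨hδ0, hρ.abs_renyiEntropy_sub_le hσ hα hδ0 h1 h2⟩
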